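/- **Setting.** A temporal graph is a tuple $\mathcal G=(V,E_1,\dots,E_\tau)$ with $V$ finite and layers $G_i=(V,E_i)$ (undirected, simple). For $1\le a\le b\le\tau$ put $G_\cap=\bigcap_{t=a}^b G_t$. A temporal clique is a pair $(C,[a,b])$, $1\le a\le b\le \tau$, $\emptyset\ne C\subseteq V$, with $C$ a clique in each $G_i$, $i\in[a,b]$. Write $\operatorname{outdeg}_G(v,C)$ for the number of neighbours of $v$ outside $C$, and $\operatorname{outdeg}_i=\operatorname{outdeg}_{G_i}$. Let $c\in\mathbb Q$. A temporal clique $(C,[a,b])$ is $c$-isolated of type - alltime-avg if $\max_{i\in[a,b]}\sum_{v\in C}\operatorname{outdeg}_i(v,C)<c|C|$; - alltime-max if $\max_{v\in C}\max_{i\in[a,b]}\operatorname{outdeg}_i(v,C)<c$; - avg-alltime if $\sum_{v\in C}\max_{i\in[a,b]}\operatorname{outdeg}_i(v,C)<c|C|$; - max-usually if $\max_{v\in C}\sum_{i=a}^b\operatorname{outdeg}_i(v,C)<c(b+1-a)$; - usually-avg if $\sum_{i=a}^b\sum_{v\in C}\operatorname{outdeg}_i(v,C)<c|C|(b+1-a)$.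 (A sixth type, usually-max, is $\sum_{i=a}^b\max_{v\in C}\operatorname{outdeg}_i(v,C)<c(b+1-a)$; the algorithm below does not treat it.) An $I$-$c$-isolated temporal clique $(C,[a,b])$ is *maximal* if there is no $I$-$c$-isolated temporal clique $(C',[a',b'])$ with $C'\supseteq C$ and $[a',b']\supsetneq[a,b]$ (time-maximality), and none $(C',[a,b])$ with $C'\supsetneq C$ (vertex-maximality). A clique $K$ of a static graph $G$ is avg-$c$-isolated if $\sum_{v\in K}\operatorname{outdeg}_G(v,K)<c|K|$. **Algorithm** (input $\mathcal G$, $c$ and one of the five types $I$). For all $1\le a\le b\le\tau$: sort $V$ by ascending degree in $G_\cap$; for each $v\in V$ compute a candidate set $C_v\subseteq V$ by a trimming stage applied to $G_\cap$, put $\delta=\deg_{G_\cap}(v)$, and for each nonempty inclusion-maximal clique $C$ of $G_\cap[C_v]$ with $|C|\ge\lfloor\delta-c+2\rfloor$ add to `result` all pairs $(C',[a,b])$ with $C'\in I$-isolatedSubsets$(C,[a,b],\delta)$. Finally output those $(C,[a,b])\in$ `result` for which $I$-isMaximal$(C,[a,b])$ returns true. Ties and the choices of "some vertex" are resolved by an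 arbitrary rule that picks an element of each nonempty vertex set. *Trimming stage.* Any procedure which, given a static graph $G$, its vertices sorted by ascending degree, and a vertex $v$, returns a set $C_v\subseteq N_G[v]$ containing every avg-$c$-isolated clique of $G$ with pivot $v$; the pivot of a clique is its first vertex in the sorted order. The *explicit trimming stage* is: let $k=\lfloor\deg(v)-c+2\rfloor$; let $S_1$ be the set of vertices of $N[v]$ not preceding $v$; if $|S_1|<k$ return $\emptyset$; let $S_2=\{u\in S_1:\deg(u)<(c+1)(\deg(v)+1)-1\}$; return $\{u\in S_2: |N[u]\cap S_2|\ge k\}$. *isolatedSubsets*$(C,[a,b],\delta)$. Let $k=\max\{1,\lfloor\delta-c+2\rfloor\}$, $d=\max\{0,\lceil|C|-\delta+c-2\rceil\}$, $\ell=b-a+1$; "the top $d$ vertices" of a set means all of its vertices if it has fewer than $d$. - alltime-max, with $s_v=\max_{i\in[a,b]}\deg_{G_i}(v)$ and $\theta(n)=n-1+c$; max-usually, with $s_v=\sum_{i\in[a,b]}\deg_{G_i}(v)$ and $\theta(n)=\ell(n-1+c)$: while $|C|\ge k$, remove from $C$ some $v\in C$ with $s_v\ge\theta(|C|)$ if there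 is one, and otherwise return $\{C\}$. If the loop ends, return $\emptyset$. - avg-alltime, with $s_v=\max_{i\in[a,b]}\deg_{G_i}(v)$ and $\Theta(n)=n(n-1+c)$; usually-avg, with $s_v=\sum_{i\in[a,b]}\deg_{G_i}(v)$ and $\Theta(n)=\ell n(n-1+c)$: let $v_1,v_2,\dots$ be the top $d$ vertices of $C$ by $s_v$. Start with $\mathcal D=\{\emptyset\}$. In each round treat every $D\in\mathcal D$: with $C'=C\setminus D$, if $\sum_{v\in C'}s_v\ge\Theta(|C'|)$, put all $D\cup\{v_i\}$ with $i>\max\{0,j: v_j\in D\}$ into the next $\mathcal D$; otherwise add $C'$ to the returned family. Stop when $\mathcal D=\emptyset$. - alltime-avg: the same search, with the test $\exists i\in[a,b]:\sum_{v\in C'}\deg_{G_i}(v)\ge|C'|(|C'|-1+c)$; if it holds, take the smallest such $i$ and, provided $|C'|>\delta-c+2$, put all $D\cup\{e\}$ into the next $\mathcal D$, $e$ running over the top $d$ vertices of $C'$ by $\deg_{G_i}$; otherwise add $C'$ to the returned family. *isMaximal*$(C,[a,b])$. For alltime-avg, alltime-max and avg-alltime: return false if $(C,[a-1,b])$ or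 $(C,[a,b+1])$ is an $I$-$c$-isolated temporal clique; otherwise return isVertexMaximal$(C,[a,b])$. For max-usually and usually-avg: for $a'=a,a-1,\dots,1$ (leaving the loop when $C$ is not a clique in $G_{a'}$) and $b'=b,\dots,\tau$ (leaving the inner loop when $C$ is not a clique in $G_{b'}$), return false if $(C,[a',b'])$ is $I$-$c$-isolated and $(a',b')\ne(a,b)$, or if isVertexMaximal$(C,[a',b'])$ is false; at the end return true. *isVertexMaximal*$(C,[a,b])$. For alltime-avg: return false iff `result` contains some $(C',[a,b])$ with $C'\supsetneq C$. For the other four types: let $G_\cap=\bigcap_{i=a}^bG_i$, let $w\in C$ have minimum degree in $G_\cap$, and let $S=\{v\in N_{G_\cap}(w)\setminus C: N_{G_\cap}(v)\supseteq C\}$. For each maximal clique $D$ of $G_\cap[S]$: while $D\neq\emptyset$ and $(C\cup D,[a,b])$ is not $I$-$c$-isolated, remove from $D$ a vertex with the highest value of $\sum_{i=a}^b\deg_{G_i}$ (max-usually, usually-avg) or $\max_{i\in[a,b]}\deg_{G_i}$ (alltime-max, avg-alltime). Return false if some $D$ is nonempty at the end, and true otherwise. **Proposition.** Let $\mathcal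 G$ be a temporal graph, $c\in\mathbb Q$, and $I$ one of the five types alltime-avg, alltime-max, avg-alltime, max-usually, usually-avg. Then the explicit trimming stage is a trimming stage, and for every trimming stage and every choice rule the set output by the algorithm is exactly the set of all maximal $I$-$c$-isolated temporal cliques of $\mathcal G$. -/

import Mathlib

/-! ### Temporal graphs, temporal cliques and isolation -/

/-- A temporal graph `(V, E₁, …, E_τ)`: the `i`-th entry of `layers` is the layer `(V, E_{i+1})`. -/
structure TemporalGraph (V : Type*) where
  τ : ℕ
  layers : Fin τ → SimpleGraph V
  decAdj : ∀ i, DecidableRel (layers i).Adj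

/-- The number of edges with one endpoint `v` and the other one outside of `A`. -/
def outdeg {V : Type*} [Fintype V] [DecidableEq V] (G : SimpleGraph V) [DecidableRel G.Adj]
    (v : V) (A : Finset V) : ℕ :=
  (G.neighborFinset v \ A).card

/-- avg-`c`-isolation of a vertex set in a static graph. -/
def AvgIsolated {V : Type*} [Fintype V] [DecidableEq V] (G : SimpleGraph V) [DecidableRel G.Adj]
    (c : ℚ) (C : Finset V) : Prop :=
  ((∑ v ∈ C, outdeg G v C : ℕ) : ℚ) < c * C.card

namespace TemporalGraph

/-- The layer `G_t = (V, E_t)` for `1 ≤ t ≤ τ` (and the edgeless graph for all other `t`). -/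
def layer {V : Type*} (𝒢 : TemporalGraph V) (t : ℕ) : SimpleGraph V where
  Adj u v := ∃ h : 1 ≤ t ∧ t ≤ 𝒢.τ, (𝒢.layers ⟨t - 1, by omega⟩).Adj u v
  symm := ⟨fun _ _ ⟨h, huv⟩ => ⟨h, huv.symm⟩⟩
  loopless := ⟨fun _ ⟨_, h⟩ => h.ne rfl⟩

instance layer.decidableRel {V : Type*} (𝒢 : TemporalGraph V) (t : ℕ) :
    DecidableRel (𝒢.layer t).Adj := fun u v =>
  if h : 1 ≤ t ∧ t ≤ 𝒢.τ then
    @decidable_of_iff _ _ ⟨fun h' => ⟨h, h'⟩, fun ⟨_, h'⟩ => h'⟩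
      (𝒢.decAdj ⟨t - 1, by omega⟩ u v)
  else isFalse fun ⟨h', _⟩ => h h'

/-- The static graph `G_∩ = ⋂_{t=a}^b G_t`. -/
def inter {V : Type*} (𝒢 : TemporalGraph V) (a b : ℕ) : SimpleGraph V where
  Adj u v := u ≠ v ∧ ∀ t ∈ Finset.Icc a b, (𝒢.layer t).Adj u v
  symm := ⟨fun _ _ ⟨h, huv⟩ => ⟨h.symm, fun t ht => (huv t ht).symm⟩⟩
  loopless := ⟨fun _ h => h.1 rfl⟩

instance inter.decidableRel {V : Type*} [DecidableEq V] (𝒢 : TemporalGraph V) (a b : ℕ) :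
    DecidableRel (𝒢.inter a b).Adj := fun u v =>
  inferInstanceAs (Decidable (u ≠ v ∧ ∀ t ∈ Finset.Icc a b, (𝒢.layer t).Adj u v))

/-- `(C, [a, b])` is a temporal clique: a (nonempty) clique in each layer of the time window. -/
def IsTemporalClique {V : Type*} (𝒢 : TemporalGraph V) (C : Finset V) (a b : ℕ) : Prop :=
  C.Nonempty ∧ (1 ≤ a ∧ a ≤ b ∧ b ≤ 𝒢.τ) ∧
    ∀ t ∈ Finset.Icc a b, (𝒢.layer t).IsClique (C : Set V)

instance {V : Type*} [DecidableEq V] (𝒢 : TemporalGraph V) (C : Finset V) (a b : ℕ) :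
    Decidable (𝒢.IsTemporalClique C a b) := by
  unfold IsTemporalClique; infer_instance

end TemporalGraph

/-- The six types of temporal isolation. -/
inductive IsolationType where
  | alltimeAvg
  | alltimeMax
  | avgAlltime
  | maxUsually
  | usuallyAvg
  | usuallyMax
  deriving DecidableEq

namespace TemporalGraph

/-- The isolation inequality of type `I` for the pair `(C, [a, b])`. Every maximum is taken over a
nonempty set when `C ≠ ∅` and `a ≤ b`. -/
def Isolated {V : Type*} [Fintype V] [DecidableEq V] (𝒢 : TemporalGraph V) (I : IsolationType)
    (c : ℚ) (C : Finset V) (a b : ℕ) : Prop :=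
  match I with
  | .alltimeAvg =>
    (((Finset.Icc a b).sup fun i => ∑ v ∈ C, outdeg (𝒢.layer i) v C : ℕ) : ℚ) < c * C.card
  | .alltimeMax =>
    ((C.sup fun v => (Finset.Icc a b).sup fun i => outdeg (𝒢.layer i) v C : ℕ) : ℚ) < c
  | .avgAlltime =>
    ((∑ v ∈ C, (Finset.Icc a b).sup fun i => outdeg (𝒢.layer i) v C : ℕ) : ℚ) < c * C.card
  | .maxUsually =>
    ((C.sup fun v => ∑ i ∈ Finset.Icc a b, outdeg (𝒢.layer i) v C : ℕ) : ℚ)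
      < c * ((b : ℚ) + 1 - a)
  | .usuallyAvg =>
    ((∑ i ∈ Finset.Icc a b, ∑ v ∈ C, outdeg (𝒢.layer i) v C : ℕ) : ℚ)
      < c * C.card * ((b : ℚ) + 1 - a)
  | .usuallyMax =>
    ((∑ i ∈ Finset.Icc a b, C.sup fun v => outdeg (𝒢.layer i) v C : ℕ) : ℚ)
      < c * ((b : ℚ) + 1 - a)

instance {V : Type*} [Fintype V] [DecidableEq V] (𝒢 : TemporalGraph V) (I : IsolationType)
    (c : ℚ) (C : Finset V) (a b : ℕ) : Decidable (𝒢.Isolated I c C a b) := by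
  cases I <;> unfold Isolated <;> infer_instance

/-- `(C, [a, b])` is an `I`-`c`-isolated temporal clique. -/
def IsIsolatedClique {V : Type*} [Fintype V] [DecidableEq V] (𝒢 : TemporalGraph V)
    (I : IsolationType) (c : ℚ) (C : Finset V) (a b : ℕ) : Prop :=
  𝒢.IsTemporalClique C a b ∧ 𝒢.Isolated I c C a b

instance {V : Type*} [Fintype V] [DecidableEq V] (𝒢 : TemporalGraph V) (I : IsolationType)
    (c : ℚ) (C : Finset V) (a b : ℕ) : Decidable (𝒢.IsIsolatedClique I c C a b) := by
  unfold IsIsolatedClique; infer_instance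

/-- No isolated clique on a superset of `C` has a strictly larger time window. -/
def TimeMaximal {V : Type*} [Fintype V] [DecidableEq V] (𝒢 : TemporalGraph V)
    (I : IsolationType) (c : ℚ) (C : Finset V) (a b : ℕ) : Prop :=
  ¬ ∃ (C' : Finset V) (a' b' : ℕ), 𝒢.IsIsolatedClique I c C' a' b' ∧ C ⊆ C' ∧
    Finset.Icc a b ⊂ Finset.Icc a' b'

/-- No isolated clique with the same time window has a strictly larger vertex set. -/
def VertexMaximal {V : Type*} [Fintype V] [DecidableEq V] (𝒢 : TemporalGraph V)
    (I : IsolationType) (c : ℚ) (C : Finset V) (a b : ℕ) : Prop :=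
  ¬ ∃ C' : Finset V, 𝒢.IsIsolatedClique I c C' a b ∧ C ⊂ C'

/-- `(C, [a, b])` is a maximal `I`-`c`-isolated temporal clique. -/
def IsMaximalIsolatedClique {V : Type*} [Fintype V] [DecidableEq V] (𝒢 : TemporalGraph V)
    (I : IsolationType) (c : ℚ) (C : Finset V) (a b : ℕ) : Prop :=
  𝒢.IsIsolatedClique I c C a b ∧ 𝒢.TimeMaximal I c C a b ∧ 𝒢.VertexMaximal I c C a b

end TemporalGraph

/-! ### Elementary operations of the algorithm -/

/-- A rule that resolves the free choices of the algorithm ("some vertex with …", ties in an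
`argmin` / `argmax`, ties in sorting): it picks an element of every nonempty vertex set. -/
abbrev ChoiceRule (V : Type*) := ∀ s : Finset V, s.Nonempty → {v : V // v ∈ s}

/-- A vertex of `S` with the highest value of `f`. -/
def argmaxOf {V : Type*} [DecidableEq V] (pick : ChoiceRule V) (f : V → ℕ) (S : Finset V)
    (h : S.Nonempty) : {v : V // v ∈ S} :=
  let v := pick (S.filter fun v => ∀ u ∈ S, f u ≤ f v) (by
    obtain ⟨v, hv, hmax⟩ := S.exists_max_image f h
    exact ⟨v, Finset.mem_filter.2 ⟨hv, hmax⟩⟩)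
  ⟨v.1, (Finset.mem_filter.1 v.2).1⟩

/-- A vertex of `S` with the lowest value of `f`. -/
def argminOf {V : Type*} [DecidableEq V] (pick : ChoiceRule V) (f : V → ℕ) (S : Finset V)
    (h : S.Nonempty) : {v : V // v ∈ S} :=
  let v := pick (S.filter fun v => ∀ u ∈ S, f v ≤ f u) (by
    obtain ⟨v, hv, hmin⟩ := S.exists_min_image f h
    exact ⟨v, Finset.mem_filter.2 ⟨hv, hmin⟩⟩)
  ⟨v.1, (Finset.mem_filter.1 v.2).1⟩

/-- The `d` vertices of `S` with the highest values of `f` (all of `S` if `d ≥ |S|`), listed by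
descending value. -/
def topList {V : Type*} [DecidableEq V] (pick : ChoiceRule V) (f : V → ℕ) :
    ℕ → Finset V → List V
  | 0, _ => []
  | d + 1, S =>
    if h : S.Nonempty then
      let v := (argmaxOf pick f S h).1
      v :: topList pick f d (S.erase v)
    else []

/-- All vertices, sorted by ascending degree. -/
def sortByDegree {V : Type*} [Fintype V] [DecidableEq V] (pick : ChoiceRule V)
    (G : SimpleGraph V) [DecidableRel G.Adj] : List V :=
  (topList pick (fun v => G.degree v) (Fintype.card V) Finset.univ).reverse

/-- All (nonempty) maximal cliques of `G[S]`. -/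
def maximalCliques {V : Type*} [DecidableEq V] (G : SimpleGraph V) [DecidableRel G.Adj]
    (S : Finset V) : Finset (Finset V) :=
  S.powerset.filter fun K => K.Nonempty ∧ G.IsClique (K : Set V) ∧
    ∀ u ∈ S \ K, ¬ G.IsClique ((insert u K : Finset V) : Set V)

/-- `v` is the pivot of `K`: the vertex of `K` that comes first in the given order. -/
def IsPivot {V : Type*} [DecidableEq V] (order : List V) (v : V) (K : Finset V) : Prop :=
  v ∈ K ∧ ∀ u ∈ K, order.idxOf v ≤ order.idxOf u

/-- A procedure that computes a candidate set from a static graph, the list of its vertices sorted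
by degree, and a pivot vertex. -/
abbrev TrimmingProcedure (V : Type*) :=
  (G : SimpleGraph V) → [DecidableRel G.Adj] → (order : List V) → (v : V) → Finset V

/-- What a trimming stage has to deliver: given the vertices sorted by ascending degree, the
candidate set for `v` is a subset of `N[v]` that contains all avg-`c`-isolated cliques with
pivot `v`. -/
def IsTrimming {V : Type*} [Fintype V] [DecidableEq V] (c : ℚ) (trim : TrimmingProcedure V) :
    Prop :=
  ∀ (G : SimpleGraph V) [DecidableRel G.Adj] (order : List V),
    order.Nodup → (∀ v, v ∈ order) → order.Pairwise (fun u v => G.degree u ≤ G.degree v) →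
    ∀ v, trim G order v ⊆ insert v (G.neighborFinset v) ∧
      ∀ K : Finset V, G.IsClique (K : Set V) → AvgIsolated G c K → IsPivot order v K →
        K ⊆ trim G order v

/-- An explicit trimming stage. From `N[v]` discard the vertices that precede `v`; give up if too
few vertices remain; then discard the vertices of too high degree; finally discard the vertices
that have too few neighbours among those that remain. -/
def pivotTrimming {V : Type*} [Fintype V] [DecidableEq V] (c : ℚ) : TrimmingProcedure V :=
  fun G _ order v =>
    let k : ℤ := ⌊(G.degree v : ℚ) - c + 2⌋
    let S₁ := (insert v (G.neighborFinset v)).filter fun u => order.idxOf v ≤ order.idxOf u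
    if (S₁.card : ℤ) < k then ∅
    else
      let S₂ := S₁.filter fun u => (G.degree u : ℚ) < (c + 1) * (G.degree v + 1) - 1
      S₂.filter fun u => k ≤ ((insert u (G.neighborFinset u) ∩ S₂).card : ℤ)

/-! ### Enumerating isolated subsets -/

/-- The number `⌊δ - c + 2⌋`, which is a lower bound on the size of an isolated clique; cliques
are nonempty, so it is raised to `1` if necessary. -/
def sizeBound (c : ℚ) (δ : ℕ) : ℤ := max 1 ⌊(δ : ℚ) - c + 2⌋

/-- The number `|C| - ⌊δ - c + 2⌋ = ⌈|C| - δ + c - 2⌉` of vertices of `C` that may be removed. -/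
def removalBound {V : Type*} (c : ℚ) (δ : ℕ) (C : Finset V) : ℕ :=
  ⌈(C.card : ℚ) - δ + c - 2⌉.toNat

/-- `while |C| ≥ k`: if some `v ∈ C` has `s v ≥ thr |C|`, remove such a vertex from `C`, else
return `{C}`. If the loop ends, return `∅`. -/
def greedyRemoval {V : Type*} [DecidableEq V] (pick : ChoiceRule V) (k : ℤ) (s : V → ℕ)
    (thr : ℕ → ℚ) (C : Finset V) : Finset (Finset V) :=
  if k ≤ C.card then
    if h : (C.filter fun v => thr C.card ≤ (s v : ℚ)).Nonempty then
      greedyRemoval pick k s thr (C.erase (pick _ h).1)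
    else {C}
  else ∅
termination_by C.card
decreasing_by
  exact Finset.card_erase_lt_of_mem (Finset.mem_filter.1 (pick _ h).2).1

/-- The breadth-first search over removal sets. In each round, every `D ∈ 𝒟` for which `C \ D`
passes the test contributes `C \ D` to the result, and every other `D ∈ 𝒟` is replaced by the sets
`D ∪ {e}` with `e ∈ branch D` (where `e ∈ C \ D`); the search ends when `𝒟 = ∅`. -/
def searchRemovals {V : Type*} [DecidableEq V] (C : Finset V) (test : Finset V → Prop)
    [DecidablePred test] (branch : Finset V → Finset V) (𝒟 result : Finset (Finset V)) :
    Finset (Finset V) :=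
  if h : 𝒟.Nonempty then
    searchRemovals C test branch
      ((𝒟.filter fun D => ¬ test (C \ D)).biUnion fun D =>
        (branch D ∩ (C \ D)).image fun e => insert e D)
      (result ∪ (𝒟.filter fun D => test (C \ D)).image fun D => C \ D)
  else result
termination_by 𝒟.sup fun D => (C \ D).card + 1
decreasing_by
  obtain ⟨D₀, hD₀⟩ := h
  have hpos : ⊥ < 𝒟.sup fun D => (C \ D).card + 1 :=
    lt_of_lt_of_le (Nat.succ_pos _) (Finset.le_sup (f := fun D => (C \ D).card + 1) hD₀)
  refine (Finset.sup_lt_iff hpos).2 fun D' hD' => ?_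
  obtain ⟨D, hD, hD'⟩ := Finset.mem_biUnion.1 hD'
  obtain ⟨e, he, rfl⟩ := Finset.mem_image.1 hD'
  have he' : e ∈ C \ D := (Finset.mem_inter.1 he).2
  have hlt : (C \ insert e D).card < (C \ D).card := by
    refine Finset.card_lt_card ((Finset.ssubset_iff_of_subset ?_).2 ⟨e, he', by simp⟩)
    exact Finset.sdiff_subset_sdiff (Finset.Subset.refl _) (Finset.subset_insert _ _)
  exact lt_of_lt_of_le (Nat.succ_lt_succ hlt)
    (Finset.le_sup (f := fun D => (C \ D).card + 1) (Finset.mem_filter.1 hD).1)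

/-- The vertices `v_i` of the list `[v_1, …, v_d]` with `i > max {0, j ; v_j ∈ D}`. -/
def laterCandidates {V : Type*} [DecidableEq V] (L : List V) (D : Finset V) : Finset V :=
  ((Finset.univ : Finset (Fin L.length)).filter fun i => ∀ j, L.get j ∈ D → j < i).image L.get

namespace TemporalGraph

/-- `max_{i ∈ [a, b]} deg_{G_i}(v)`. -/
def maxDegree {V : Type*} [Fintype V] (𝒢 : TemporalGraph V) (a b : ℕ) (v : V) : ℕ :=
  (Finset.Icc a b).sup fun i => (𝒢.layer i).degree v

/-- `∑_{i ∈ [a, b]} deg_{G_i}(v)`. -/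
def sumDegree {V : Type*} [Fintype V] (𝒢 : TemporalGraph V) (a b : ℕ) (v : V) : ℕ :=
  ∑ i ∈ Finset.Icc a b, (𝒢.layer i).degree v

/-- The layers of `[a, b]` with `∑_{v ∈ C'} deg_{G_i}(v) ≥ |C'| (|C'| - 1 + c)`. -/
def violatedLayers {V : Type*} [Fintype V] (𝒢 : TemporalGraph V) (c : ℚ)
    (a b : ℕ) (C' : Finset V) : Finset ℕ :=
  (Finset.Icc a b).filter fun i =>
    (C'.card : ℚ) * ((C'.card : ℚ) - 1 + c) ≤ ((∑ v ∈ C', (𝒢.layer i).degree v : ℕ) : ℚ)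

def alltimeAvgSubsets {V : Type*} [Fintype V] [DecidableEq V] (𝒢 : TemporalGraph V)
    (pick : ChoiceRule V) (c : ℚ) (C : Finset V) (a b δ : ℕ) : Finset (Finset V) :=
  let d := removalBound c δ C
  searchRemovals C (fun C' => ¬ (𝒢.violatedLayers c a b C').Nonempty)
    (fun D =>
      let C' := C \ D
      if h : (𝒢.violatedLayers c a b C').Nonempty then
        let i := (𝒢.violatedLayers c a b C').min' h
        if (δ : ℚ) - c + 2 < C'.card then
          (topList pick (fun v => (𝒢.layer i).degree v) d C').toFinset
        else ∅
      else ∅)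
    {∅} ∅

def alltimeMaxSubsets {V : Type*} [Fintype V] [DecidableEq V] (𝒢 : TemporalGraph V)
    (pick : ChoiceRule V) (c : ℚ) (C : Finset V) (a b δ : ℕ) : Finset (Finset V) :=
  greedyRemoval pick (sizeBound c δ) (𝒢.maxDegree a b) (fun n => (n : ℚ) - 1 + c) C

def avgAlltimeSubsets {V : Type*} [Fintype V] [DecidableEq V] (𝒢 : TemporalGraph V)
    (pick : ChoiceRule V) (c : ℚ) (C : Finset V) (a b δ : ℕ) : Finset (Finset V) :=
  let s := 𝒢.maxDegree a b
  searchRemovals C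
    (fun C' => ¬ (C'.card : ℚ) * ((C'.card : ℚ) - 1 + c) ≤ ((∑ v ∈ C', s v : ℕ) : ℚ))
    (laterCandidates (topList pick s (removalBound c δ C) C)) {∅} ∅

def maxUsuallySubsets {V : Type*} [Fintype V] [DecidableEq V] (𝒢 : TemporalGraph V)
    (pick : ChoiceRule V) (c : ℚ) (C : Finset V) (a b δ : ℕ) : Finset (Finset V) :=
  greedyRemoval pick (sizeBound c δ) (𝒢.sumDegree a b)
    (fun n => ((b : ℚ) - a + 1) * ((n : ℚ) - 1 + c)) C

def usuallyAvgSubsets {V : Type*} [Fintype V] [DecidableEq V] (𝒢 : TemporalGraph V)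
    (pick : ChoiceRule V) (c : ℚ) (C : Finset V) (a b δ : ℕ) : Finset (Finset V) :=
  let s := 𝒢.sumDegree a b
  searchRemovals C
    (fun C' => ¬ ((b : ℚ) - a + 1) * C'.card * ((C'.card : ℚ) - 1 + c)
      ≤ ((∑ v ∈ C', s v : ℕ) : ℚ))
    (laterCandidates (topList pick s (removalBound c δ C) C)) {∅} ∅

/-- The subroutine `I-isolatedSubsets(C, [a, b], δ)`. There is none for usually-max-isolation. -/
def isolatedSubsets {V : Type*} [Fintype V] [DecidableEq V] (𝒢 : TemporalGraph V)
    (pick : ChoiceRule V) (I : IsolationType) (c : ℚ) (C : Finset V) (a b δ : ℕ) :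
    Finset (Finset V) :=
  match I with
  | .alltimeAvg => 𝒢.alltimeAvgSubsets pick c C a b δ
  | .alltimeMax => 𝒢.alltimeMaxSubsets pick c C a b δ
  | .avgAlltime => 𝒢.avgAlltimeSubsets pick c C a b δ
  | .maxUsually => 𝒢.maxUsuallySubsets pick c C a b δ
  | .usuallyAvg => 𝒢.usuallyAvgSubsets pick c C a b δ
  | .usuallyMax => ∅

/-! ### Checking for maximality -/

/-- `while D ≠ ∅` and `(C ∪ D, [a, b])` is not isolated, remove from `D` a vertex of highest
`score`; return the final `D`. -/
def shrink {V : Type*} [Fintype V] [DecidableEq V] (𝒢 : TemporalGraph V) (pick : ChoiceRule V)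
    (I : IsolationType) (c : ℚ) (score : V → ℕ) (C : Finset V) (a b : ℕ) (D : Finset V) :
    Finset V :=
  if h : D.Nonempty then
    if 𝒢.Isolated I c (C ∪ D) a b then D
    else 𝒢.shrink pick I c score C a b (D.erase (argmaxOf pick score D h).1)
  else D
termination_by D.card
decreasing_by exact Finset.card_erase_lt_of_mem (argmaxOf pick score D h).2

/-- `isVertexMaximal(C, [a, b])` for alltime-avg-isolation. -/
def vertexMaximalByComparison {V : Type*} [DecidableEq V]
    (result : Finset (Finset V × ℕ × ℕ)) (C : Finset V) (a b : ℕ) : Bool :=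
  decide (¬ ∃ x ∈ result, x.2 = (a, b) ∧ C ⊂ x.1)

/-- `I-isVertexMaximal(C, [a, b])` for the isolation types other than alltime-avg. (It is called
for nonempty `C` only.) -/
def vertexMaximalBySearch {V : Type*} [Fintype V] [DecidableEq V] (𝒢 : TemporalGraph V)
    (pick : ChoiceRule V) (I : IsolationType) (c : ℚ) (C : Finset V) (a b : ℕ) : Bool :=
  if h : C.Nonempty then
    let w := (argminOf pick (fun v => (𝒢.inter a b).degree v) C h).1
    let S := ((𝒢.inter a b).neighborFinset w \ C).filter fun v =>
      C ⊆ (𝒢.inter a b).neighborFinset v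
    let score := match I with
      | .maxUsually | .usuallyAvg => 𝒢.sumDegree a b
      | _ => 𝒢.maxDegree a b
    decide (∀ D ∈ maximalCliques (𝒢.inter a b) S, 𝒢.shrink pick I c score C a b D = ∅)
  else true

/-- The subroutine `I-isVertexMaximal(C, [a, b])`. -/
def isVertexMaximal {V : Type*} [Fintype V] [DecidableEq V] (𝒢 : TemporalGraph V)
    (pick : ChoiceRule V) (I : IsolationType) (c : ℚ) (result : Finset (Finset V × ℕ × ℕ))
    (C : Finset V) (a b : ℕ) : Bool :=
  match I with
  | .alltimeAvg => vertexMaximalByComparison result C a b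
  | _ => 𝒢.vertexMaximalBySearch pick I c C a b

/-- `I-isMaximal(C, [a, b])` for the three alltime isolation types. -/
def isMaximalAlltime {V : Type*} [Fintype V] [DecidableEq V] (𝒢 : TemporalGraph V)
    (pick : ChoiceRule V) (I : IsolationType) (c : ℚ) (result : Finset (Finset V × ℕ × ℕ))
    (C : Finset V) (a b : ℕ) : Bool :=
  if 𝒢.IsIsolatedClique I c C (a - 1) b then false
  else if 𝒢.IsIsolatedClique I c C a (b + 1) then false
  else 𝒢.isVertexMaximal pick I c result C a b

/-- The inner loop of `isMaximalUsually` for a fixed left end `a'`: `b'` runs upwards, and the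
first argument is the number of iterations that are left. The value `true` means that the loop
ended (by a break or regularly), `false` that the function returned false. -/
def usuallyInnerLoop {V : Type*} [Fintype V] [DecidableEq V] (𝒢 : TemporalGraph V)
    (pick : ChoiceRule V) (I : IsolationType) (c : ℚ) (result : Finset (Finset V × ℕ × ℕ))
    (C : Finset V) (a b a' : ℕ) : ℕ → ℕ → Bool
  | 0, _ => true
  | n + 1, b' =>
    if ¬ (𝒢.layer b').IsClique (C : Set V) then true
    else if 𝒢.Isolated I c C a' b' ∧ (a, b) ≠ (a', b') then false
    else if 𝒢.isVertexMaximal pick I c result C a' b' = false then false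
    else 𝒢.usuallyInnerLoop pick I c result C a b a' n (b' + 1)

/-- The outer loop of `isMaximalUsually`: the last argument `a'` runs downwards to `1`. -/
def usuallyOuterLoop {V : Type*} [Fintype V] [DecidableEq V] (𝒢 : TemporalGraph V)
    (pick : ChoiceRule V) (I : IsolationType) (c : ℚ) (result : Finset (Finset V × ℕ × ℕ))
    (C : Finset V) (a b : ℕ) : ℕ → Bool
  | 0 => true
  | a' + 1 =>
    if ¬ (𝒢.layer (a' + 1)).IsClique (C : Set V) then true
    else if 𝒢.usuallyInnerLoop pick I c result C a b (a' + 1) (𝒢.τ + 1 - b) b = false then false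
    else 𝒢.usuallyOuterLoop pick I c result C a b a'

/-- `I-isMaximal(C, [a, b])` for max-usually- and usually-avg-isolation. -/
def isMaximalUsually {V : Type*} [Fintype V] [DecidableEq V] (𝒢 : TemporalGraph V)
    (pick : ChoiceRule V) (I : IsolationType) (c : ℚ) (result : Finset (Finset V × ℕ × ℕ))
    (C : Finset V) (a b : ℕ) : Bool :=
  𝒢.usuallyOuterLoop pick I c result C a b a

/-- The subroutine `I-isMaximal(C, [a, b])`. There is none for usually-max-isolation. -/
def isMaximal {V : Type*} [Fintype V] [DecidableEq V] (𝒢 : TemporalGraph V)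
    (pick : ChoiceRule V) (I : IsolationType) (c : ℚ) (result : Finset (Finset V × ℕ × ℕ))
    (C : Finset V) (a b : ℕ) : Bool :=
  match I with
  | .alltimeAvg | .alltimeMax | .avgAlltime => 𝒢.isMaximalAlltime pick I c result C a b
  | .maxUsually | .usuallyAvg => 𝒢.isMaximalUsually pick I c result C a b
  | .usuallyMax => false

/-! ### The top level algorithm -/

/-- The set `result` after the first part of the algorithm: for each time window `[a, b]`, each
pivot `v` and each maximal clique `C` of sufficient size within the candidate set of `v` in `G_∩`,
it collects the isolated subsets of `C`. -/
def collectResult {V : Type*} [Fintype V] [DecidableEq V] (𝒢 : TemporalGraph V)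
    (pick : ChoiceRule V) (trim : TrimmingProcedure V) (I : IsolationType) (c : ℚ) :
    Finset (Finset V × ℕ × ℕ) :=
  (Finset.Icc 1 𝒢.τ).biUnion fun a =>
    (Finset.Icc a 𝒢.τ).biUnion fun b =>
      let order := sortByDegree pick (𝒢.inter a b)
      (Finset.univ : Finset V).biUnion fun v =>
        let δ := (𝒢.inter a b).degree v
        let Cv := trim (𝒢.inter a b) order v
        let 𝒞 := (maximalCliques (𝒢.inter a b) Cv).filter fun C => sizeBound c δ ≤ C.card
        𝒞.biUnion fun C =>
          (𝒢.isolatedSubsets pick I c C a b δ).image fun C' => (C', a, b)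

/-- The output of the algorithm; `(C, a, b)` stands for `(C, [a, b])`. -/
def enumerate {V : Type*} [Fintype V] [DecidableEq V] (𝒢 : TemporalGraph V)
    (pick : ChoiceRule V) (trim : TrimmingProcedure V) (I : IsolationType) (c : ℚ) :
    Finset (Finset V × ℕ × ℕ) :=
  let result := 𝒢.collectResult pick trim I c
  result.filter fun x => 𝒢.isMaximal pick I c result x.1 x.2.1 x.2.2 = true

end TemporalGraph

/-! ### Degrees and isolation in static graphs -/

/-! In a clique `C`, a vertex of degree `deg v` has exactly `deg v - |C| + 1` neighbours outside
`C`. Isolation therefore depends only on `|C|` and on vertex scores fixed in advance (maximum or sum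
of layer degrees): with `w` the weight of the window, the max types say that every score is below
`w(|C|-1+c)`, the sum types that the total is below `w|C|(|C|-1+c)`, and alltime-avg gives one such
sum condition per layer (`isolated_iff_forall_score`, `isolated_iff_sum_score`,
`isolated_alltimeAvg_iff`).

Degrees in `G_∩` are at most layer degrees, so each type implies avg-isolation in `G_∩`
(`IsIsolatedClique.avgIsolated_inter`). Hence a trimming stage keeps every isolated clique `K`, and
`|K| > δ - c + 1` for the pivot degree `δ`.

It remains to see that a vertex-maximal `K` inside a clique `C` is reached. For the max types, a
vertex violating the threshold of a larger set cannot lie in `K`. For the sum types, adding any `u ∈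
C \ K` breaks isolation, so `u` has score at least `w(2|K|+c)`; were `u` not among the top `d`, many
members of `K` would score as high and `K` would not be isolated (`le_sum_of_many_high`).
Alltime-avg uses the same count within one violated layer.

The vertex-maximality test rests on an exchange argument (`shrink_ne_empty`); alltime-avg, having no
single score, is compared with `result`, which already contains all vertex-maximal cliques. For
time-maximality, the alltime types pass to smaller windows, so one-step extensions suffice; the
usually types do not, so all windows are examined. -/

lemma outdeg_add_card {V : Type*} [Fintype V] [DecidableEq V] (G : SimpleGraph V)
    [DecidableRel G.Adj] {C : Finset V} (hC : G.IsClique (C : Set V)) {v : V} (hv : v ∈ C) :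
    outdeg G v C + C.card = G.degree v + 1 := by
  have h1 : G.neighborFinset v ∩ C = C.erase v := by
    ext u
    simp only [Finset.mem_inter, SimpleGraph.mem_neighborFinset, Finset.mem_erase]
    exact ⟨fun ⟨h, hu⟩ => ⟨h.ne', hu⟩, fun ⟨h, hu⟩ =>
      ⟨hC (Finset.mem_coe.2 hv) (Finset.mem_coe.2 hu) h.symm, hu⟩⟩
  have h2 := Finset.card_sdiff_add_card_inter (G.neighborFinset v) C
  rw [h1, SimpleGraph.card_neighborFinset_eq_degree] at h2
  have h3 := Finset.card_erase_add_one hv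
  unfold outdeg
  omega

lemma outdeg_eq_cast {V : Type*} [Fintype V] [DecidableEq V] (G : SimpleGraph V)
    [DecidableRel G.Adj] {C : Finset V} (hC : G.IsClique (C : Set V)) {v : V} (hv : v ∈ C) :
    (outdeg G v C : ℚ) = G.degree v - (C.card - 1) := by
  have := outdeg_add_card G hC hv
  have h : (outdeg G v C : ℚ) + C.card = G.degree v + 1 := by exact_mod_cast this
  linarith

lemma avgIsolated_iff {V : Type*} [Fintype V] [DecidableEq V] (G : SimpleGraph V)
    [DecidableRel G.Adj] {c : ℚ} {C : Finset V} (hC : G.IsClique (C : Set V)) :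
    AvgIsolated G c C ↔
      ∑ v ∈ C, (G.degree v : ℚ) < C.card * ((C.card : ℚ) - 1 + c) := by
  unfold AvgIsolated
  push_cast
  rw [Finset.sum_congr rfl fun v hv => outdeg_eq_cast G hC hv, Finset.sum_sub_distrib,
    Finset.sum_const, nsmul_eq_mul]
  constructor <;> intro h <;> linarith

/-! ### Size and degree bounds for avg-isolated cliques, and the explicit trimming stage -/

/-- The average degree over `K` is at least `δ` and, by isolation, below `|K| - 1 + c`. -/
lemma AvgIsolated.lt_card {V : Type*} [Fintype V] [DecidableEq V] {G : SimpleGraph V}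
    [DecidableRel G.Adj] {c : ℚ} {K : Finset V} (h : AvgIsolated G c K)
    (hK : G.IsClique (K : Set V)) (hne : K.Nonempty) {δ : ℕ} (hδ : ∀ u ∈ K, δ ≤ G.degree u) :
    (δ : ℚ) - c + 1 < K.card := by
  rw [avgIsolated_iff G hK] at h
  have h1 : (K.card : ℚ) * δ ≤ ∑ v ∈ K, (G.degree v : ℚ) := by
    rw [← nsmul_eq_mul]
    exact Finset.card_nsmul_le_sum _ _ _ fun u hu => by exact_mod_cast hδ u hu
  have h2 : (0 : ℚ) < K.card := by exact_mod_cast hne.card_pos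
  have := lt_of_mul_lt_mul_left (h1.trans_lt h) h2.le
  linarith

lemma floor_le_card {δ : ℚ} {c : ℚ} {n : ℕ} (h : δ - c + 1 < n) : ⌊δ - c + 2⌋ ≤ (n : ℤ) := by
  refine Int.lt_add_one_iff.1 (Int.floor_lt.2 ?_)
  push_cast
  linarith

lemma subset_closed_neighborFinset {V : Type*} [Fintype V] [DecidableEq V]
    {G : SimpleGraph V} [DecidableRel G.Adj] {K : Finset V} (hK : G.IsClique (K : Set V)) {v : V}
    (hv : v ∈ K) : K ⊆ insert v (G.neighborFinset v) := by
  intro u hu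
  rw [Finset.mem_insert, SimpleGraph.mem_neighborFinset]
  rcases eq_or_ne u v with h | h
  · exact Or.inl h
  · exact Or.inr (hK (Finset.mem_coe.2 hv) (Finset.mem_coe.2 hu) h.symm)

lemma IsPivot.degree_le {V : Type*} [Fintype V] [DecidableEq V] {G : SimpleGraph V}
    [DecidableRel G.Adj] {order : List V} (hmem : ∀ v, v ∈ order)
    (hord : order.Pairwise fun u v => G.degree u ≤ G.degree v) {v : V} {K : Finset V}
    (hv : IsPivot order v K) {u : V} (hu : u ∈ K) : G.degree v ≤ G.degree u := by
  have h1 := List.idxOf_lt_length_iff.2 (hmem v)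
  have h2 := List.idxOf_lt_length_iff.2 (hmem u)
  rcases (hv.2 u hu).lt_or_eq with h | h
  · have := List.pairwise_iff_getElem.1 hord _ _ h1 h2 h
    rwa [List.getElem_idxOf, List.getElem_idxOf] at this
  · rw [(List.idxOf_inj (hmem v)).1 h]

/-- Write `k = |K|` and `δ = deg v`. Bounding all degrees but that of `u` below by `δ` leaves `deg u
< (k-1)(k-δ) + kc`, and `k ≤ δ + 1` turns this into `δ + (δ+1)c`. -/
lemma AvgIsolated.degree_lt {V : Type*} [Fintype V] [DecidableEq V] {G : SimpleGraph V}
    [DecidableRel G.Adj] {c : ℚ} {K : Finset V} (h : AvgIsolated G c K)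
    (hK : G.IsClique (K : Set V)) {v : V} (hv : v ∈ K)
    (hδ : ∀ u ∈ K, G.degree v ≤ G.degree u) {u : V} (hu : u ∈ K) :
    (G.degree u : ℚ) < (c + 1) * (G.degree v + 1) - 1 := by
  have hpos : (0 : ℚ) < K.card := by exact_mod_cast Finset.card_pos.2 ⟨v, hv⟩
  -- Out-degree sums are nonnegative, so isolation of a nonempty set forces `c` to be positive.
  have hc : 0 < c := by
    have h' : (0 : ℚ) < c * K.card := lt_of_le_of_lt (Nat.cast_nonneg _) h
    exact pos_of_mul_pos_left h' hpos.le
  rw [avgIsolated_iff G hK, ← Finset.add_sum_erase _ _ hu] at h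
  have h1 : ((K.card : ℚ) - 1) * G.degree v ≤ ∑ w ∈ K.erase u, (G.degree w : ℚ) := by
    have h2 : ((K.erase u).card : ℚ) = K.card - 1 := by
      rw [← Finset.card_erase_add_one hu]; push_cast; ring
    rw [← h2, ← nsmul_eq_mul]
    exact Finset.card_nsmul_le_sum _ _ _ fun w hw => by
      exact_mod_cast hδ w (Finset.mem_of_mem_erase hw)
  have h3 : (K.card : ℚ) ≤ G.degree v + 1 := by
    have := Finset.card_le_card (subset_closed_neighborFinset hK hv)
    have h4 := Finset.card_insert_le v (G.neighborFinset v)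
    rw [SimpleGraph.card_neighborFinset_eq_degree] at h4
    exact_mod_cast this.trans h4
  have h5 : (1 : ℚ) ≤ K.card := by exact_mod_cast Finset.card_pos.2 ⟨v, hv⟩
  nlinarith [mul_nonneg (sub_nonneg.2 h3) (sub_nonneg.2 h5), mul_nonneg (sub_nonneg.2 h3) hc.le]

theorem isTrimming_pivotTrimming {V : Type*} [Fintype V] [DecidableEq V] (c : ℚ) :
    IsTrimming c (pivotTrimming c : TrimmingProcedure V) := by
  intro G _ order _ hmem hord v
  refine ⟨?_, fun K hK hiso hpiv => ?_⟩
  · simp only [pivotTrimming]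
    split_ifs
    · exact Finset.empty_subset _
    · exact ((Finset.filter_subset _ _).trans (Finset.filter_subset _ _)).trans
        (Finset.filter_subset _ _)
  · have hδ : ∀ u ∈ K, G.degree v ≤ G.degree u := fun u hu => hpiv.degree_le hmem hord hu
    have hk := floor_le_card (hiso.lt_card hK ⟨v, hpiv.1⟩ hδ)
    have hS₁ : K ⊆ (insert v (G.neighborFinset v)).filter
        fun u => order.idxOf v ≤ order.idxOf u := fun u hu =>
      Finset.mem_filter.2 ⟨subset_closed_neighborFinset hK hpiv.1 hu, hpiv.2 u hu⟩
    have hS₂ : K ⊆ ((insert v (G.neighborFinset v)).filter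
        fun u => order.idxOf v ≤ order.idxOf u).filter
        fun u => (G.degree u : ℚ) < (c + 1) * (G.degree v + 1) - 1 := fun u hu =>
      Finset.mem_filter.2 ⟨hS₁ hu, hiso.degree_lt hK hpiv.1 hδ hu⟩
    simp only [pivotTrimming]
    rw [if_neg (not_lt.2 (hk.trans (by exact_mod_cast Finset.card_le_card hS₁)))]
    intro u hu
    refine Finset.mem_filter.2 ⟨hS₂ hu, hk.trans ?_⟩
    -- All of `K` lies in the closed neighbourhood of each of its members, and `|K| ≥ k`.
    exact_mod_cast Finset.card_le_card
      (Finset.subset_inter (subset_closed_neighborFinset hK hu) hS₂)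

/-! ### Sorting -/

lemma le_argmaxOf {V : Type*} [DecidableEq V] (pick : ChoiceRule V) (f : V → ℕ) (S : Finset V)
    (h : S.Nonempty) {u : V} (hu : u ∈ S) : f u ≤ f (argmaxOf pick f S h).1 := by
  unfold argmaxOf
  exact (Finset.mem_filter.1 (pick (S.filter fun v => ∀ u ∈ S, f u ≤ f v) _).2).2 u hu

section TopList

variable {V : Type*} [DecidableEq V] (pick : ChoiceRule V) (f : V → ℕ)

lemma mem_of_mem_topList {d : ℕ} {S : Finset V} {v : V} (hv : v ∈ topList pick f d S) :
    v ∈ S := by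
  induction d generalizing S with
  | zero => simp [topList] at hv
  | succ d ih =>
    rw [topList] at hv
    split_ifs at hv with h
    · rcases List.mem_cons.1 hv with rfl | hv
      · exact (argmaxOf pick f S h).2
      · exact Finset.mem_of_mem_erase (ih hv)
    · simp at hv

lemma nodup_topList (d : ℕ) (S : Finset V) : (topList pick f d S).Nodup := by
  induction d generalizing S with
  | zero => simp [topList]
  | succ d ih =>
    rw [topList]
    split_ifs with h
    · exact List.nodup_cons.2 ⟨fun hv => Finset.notMem_erase _ _
        (mem_of_mem_topList pick f hv), ih _⟩
    · exact List.nodup_nil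

lemma length_topList (d : ℕ) (S : Finset V) : (topList pick f d S).length = min d S.card := by
  induction d generalizing S with
  | zero => simp [topList]
  | succ d ih =>
    rw [topList]
    split_ifs with h
    · rw [List.length_cons, ih, Finset.card_erase_of_mem (argmaxOf pick f S h).2]
      have := h.card_pos
      omega
    · simp [Finset.not_nonempty_iff_eq_empty.1 h]

lemma pairwise_topList (d : ℕ) (S : Finset V) :
    (topList pick f d S).Pairwise fun u v => f v ≤ f u := by
  induction d generalizing S with
  | zero => simp [topList]
  | succ d ih =>
    rw [topList]
    split_ifs with h
    · exact List.pairwise_cons.2 ⟨fun v hv => le_argmaxOf pick f S h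
        (Finset.mem_of_mem_erase (mem_of_mem_topList pick f hv)), ih _⟩
    · exact List.Pairwise.nil

lemma le_of_mem_topList {d : ℕ} {S : Finset V} {u v : V} (hu : u ∈ S)
    (hu' : u ∉ topList pick f d S) (hv : v ∈ topList pick f d S) : f u ≤ f v := by
  induction d generalizing S with
  | zero => simp [topList] at hv
  | succ d ih =>
    rw [topList] at hv hu'
    split_ifs at hv hu' with h
    · rw [List.mem_cons, not_or] at hu'
      rcases List.mem_cons.1 hv with rfl | hv
      · exact le_argmaxOf pick f S h hu
      · exact ih (Finset.mem_erase.2 ⟨hu'.1, hu⟩) hu'.2 hv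
    · simp at hv

/-- The list is shorter than `d` only if it exhausts `S`, which the omitted `u` excludes. -/
lemma card_toFinset_topList {d : ℕ} {S : Finset V} {u : V} (hu : u ∈ S)
    (hu' : u ∉ topList pick f d S) : (topList pick f d S).toFinset.card = d := by
  have h1 : (topList pick f d S).toFinset.card = min d S.card := by
    rw [List.toFinset_card_of_nodup (nodup_topList pick f d S), length_topList]
  have h2 : (topList pick f d S).toFinset.card < S.card :=
    Finset.card_lt_card ((Finset.ssubset_iff_of_subset fun v hv =>
      mem_of_mem_topList pick f (List.mem_toFinset.1 hv)).2
      ⟨u, hu, fun h => hu' (List.mem_toFinset.1 h)⟩)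
  omega

end TopList

section SortByDegree

variable {V : Type*} [Fintype V] [DecidableEq V] (pick : ChoiceRule V) (G : SimpleGraph V)
  [DecidableRel G.Adj]

lemma nodup_sortByDegree : (sortByDegree pick G).Nodup :=
  List.nodup_reverse.2 (nodup_topList _ _ _ _)

lemma mem_sortByDegree (v : V) : v ∈ sortByDegree pick G := by
  rw [sortByDegree, List.mem_reverse]
  by_contra h
  -- A missing vertex would leave a list of `Fintype.card V` distinct vertices, hence of all of
  -- them.
  have h1 := card_toFinset_topList pick _ (Finset.mem_univ v) h
  rw [Finset.card_eq_iff_eq_univ] at h1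
  exact h (List.mem_toFinset.1 ((Finset.ext_iff.1 h1 v).2 (Finset.mem_univ v)))

lemma pairwise_sortByDegree :
    (sortByDegree pick G).Pairwise fun u v => G.degree u ≤ G.degree v :=
  List.pairwise_reverse.2 (pairwise_topList _ _ _ _)

end SortByDegree

lemma exists_isPivot {V : Type*} [DecidableEq V] (order : List V) {K : Finset V}
    (hK : K.Nonempty) : ∃ v, IsPivot order v K :=
  K.exists_min_image order.idxOf hK

/-! ### Maximal cliques -/

lemma exists_mem_maximalCliques {V : Type*} [DecidableEq V] (G : SimpleGraph V)
    [DecidableRel G.Adj] {S K : Finset V} (hne : K.Nonempty) (hKS : K ⊆ S)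
    (hK : G.IsClique (K : Set V)) : ∃ D ∈ maximalCliques G S, K ⊆ D := by
  obtain ⟨D, hKD, hD⟩ := (S.powerset.finite_toSet.subset
    fun D (hD : D ∈ {D : Finset V | D ⊆ S ∧ G.IsClique (D : Set V)}) =>
      Finset.mem_coe.2 (Finset.mem_powerset.2 hD.1)).exists_le_maximal (a := K) ⟨hKS, hK⟩
  refine ⟨D, Finset.mem_filter.2 ⟨Finset.mem_powerset.2 hD.1.1, hne.mono hKD, hD.1.2, ?_⟩, hKD⟩
  intro u hu hclique
  rw [Finset.mem_sdiff] at hu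
  exact hu.2 (hD.2 ⟨Finset.insert_subset hu.1 hD.1.1, hclique⟩ (Finset.subset_insert _ _)
    (Finset.mem_insert_self _ _))

lemma of_mem_maximalCliques {V : Type*} [DecidableEq V] {G : SimpleGraph V}
    [DecidableRel G.Adj] {S D : Finset V} (hD : D ∈ maximalCliques G S) :
    D ⊆ S ∧ D.Nonempty ∧ G.IsClique (D : Set V) := by
  obtain ⟨h1, h2⟩ := Finset.mem_filter.1 hD
  exact ⟨Finset.mem_powerset.1 h1, h2.1, h2.2.1⟩

/-! ### The two removal procedures -/

section Removal

variable {V : Type*} [DecidableEq V]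

lemma greedyRemoval_sound (pick : ChoiceRule V) {k : ℤ} {s : V → ℕ} {thr : ℕ → ℚ}
    {C X : Finset V} (hX : X ∈ greedyRemoval pick k s thr C) :
    X ⊆ C ∧ k ≤ X.card ∧ ∀ v ∈ X, (s v : ℚ) < thr X.card := by
  induction C using Finset.strongInduction with
  | H C ih =>
    rw [greedyRemoval] at hX
    split_ifs at hX with h1 h2
    · have hmem := (Finset.mem_filter.1 (pick _ h2).2).1
      have := ih _ (Finset.erase_ssubset hmem) hX
      exact ⟨this.1.trans (Finset.erase_subset _ _), this.2⟩
    · rw [Finset.mem_singleton] at hX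
      subst hX
      refine ⟨Finset.Subset.refl _, h1, fun v hv => ?_⟩
      by_contra hlt
      exact h2 ⟨v, Finset.mem_filter.2 ⟨hv, not_lt.1 hlt⟩⟩
    · simp at hX

/-- Invariant: `K ⊆ C`. A removed vertex has score at least `thr |C| ≥ thr |K|`, so it is not in
`K`; when nothing can be removed, `C` itself satisfies the condition and maximality gives `C = K`.
-/
lemma mem_greedyRemoval (pick : ChoiceRule V) {k : ℤ} {s : V → ℕ} {thr : ℕ → ℚ}
    (hthr : Monotone thr) {C K : Finset V} (hKC : K ⊆ C) (hk : k ≤ K.card)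
    (hK : ∀ v ∈ K, (s v : ℚ) < thr K.card)
    (hmax : ∀ X, K ⊂ X → X ⊆ C → ¬ ∀ v ∈ X, (s v : ℚ) < thr X.card) :
    K ∈ greedyRemoval pick k s thr C := by
  induction C using Finset.strongInduction with
  | H C ih =>
    rw [greedyRemoval, if_pos (hk.trans (by exact_mod_cast Finset.card_le_card hKC))]
    split_ifs with h2
    · obtain ⟨hmem, hle⟩ := Finset.mem_filter.1 (pick _ h2).2
      refine ih _ (Finset.erase_ssubset hmem) (fun v hv => Finset.mem_erase.2 ⟨?_, hKC hv⟩)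
        fun X hX hXC => hmax X hX (hXC.trans (Finset.erase_subset _ _))
      intro hv'
      rw [← hv'] at hle
      exact absurd (hle.trans_lt (hK v hv)) (not_lt.2 (hthr (Finset.card_le_card hKC)))
    · rw [Finset.mem_singleton]
      by_contra hne
      refine hmax C (hKC.ssubset_of_ne hne) (Finset.Subset.refl _) fun v hv => ?_
      by_contra hlt
      exact h2 ⟨v, Finset.mem_filter.2 ⟨hv, not_lt.1 hlt⟩⟩

lemma searchRemovals_sound {C : Finset V} {test : Finset V → Prop} [DecidablePred test]
    {branch : Finset V → Finset V} {𝒟 R : Finset (Finset V)} {X : Finset V}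
    (hX : X ∈ searchRemovals C test branch 𝒟 R) : X ∈ R ∨ X ⊆ C ∧ test X := by
  induction 𝒟, R using searchRemovals.induct C test branch with
  | case1 𝒟 R h ih =>
    rw [searchRemovals, dif_pos h] at hX
    rcases ih hX with h' | h'
    · rcases Finset.mem_union.1 h' with h' | h'
      · exact Or.inl h'
      · obtain ⟨D, hD, rfl⟩ := Finset.mem_image.1 h'
        exact Or.inr ⟨Finset.sdiff_subset, (Finset.mem_filter.1 hD).2⟩
    · exact Or.inr h'
  | case2 𝒟 R h =>
    rw [searchRemovals, dif_neg h] at hX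
    exact Or.inl hX

/-- `P` marks the removal sets on a path towards `K`: some `D` in the current family satisfies it
until `K` has been recorded. As the search stops only at the empty family, `K` does get recorded. -/
lemma mem_searchRemovals {C : Finset V} {test : Finset V → Prop} [DecidablePred test]
    {branch : Finset V → Finset V} {K : Finset V} (P : Finset V → Prop)
    (hdone : ∀ D, P D → test (C \ D) → C \ D = K)
    (hstep : ∀ D, P D → ¬ test (C \ D) → ∃ e ∈ branch D, e ∈ C \ D ∧ P (insert e D))
    {𝒟 R : Finset (Finset V)} (h : K ∈ R ∨ ∃ D ∈ 𝒟, P D) :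
    K ∈ searchRemovals C test branch 𝒟 R := by
  induction 𝒟, R using searchRemovals.induct C test branch with
  | case1 𝒟 R h𝒟 ih =>
    rw [searchRemovals, dif_pos h𝒟]
    apply ih
    rcases h with h | ⟨D, hD, hP⟩
    · exact Or.inl (Finset.mem_union_left _ h)
    · by_cases ht : test (C \ D)
      · exact Or.inl (Finset.mem_union_right _ (Finset.mem_image.2
          ⟨D, Finset.mem_filter.2 ⟨hD, ht⟩, hdone D hP ht⟩))
      · obtain ⟨e, he, he', hP'⟩ := hstep D hP ht
        exact Or.inr ⟨insert e D, Finset.mem_biUnion.2 ⟨D, Finset.mem_filter.2 ⟨hD, ht⟩,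
          Finset.mem_image.2 ⟨e, Finset.mem_inter.2 ⟨he, he'⟩, rfl⟩⟩, hP'⟩
  | case2 𝒟 R h𝒟 =>
    rw [searchRemovals, dif_neg h𝒟]
    rcases h with h | ⟨D, hD, _⟩
    · exact h
    · exact absurd ⟨D, hD⟩ h𝒟

lemma mem_laterCandidates {L : List V} {D : Finset V} {e : V} (he : e ∈ L)
    (h : ∀ x ∈ D, x ∈ L → L.idxOf x < L.idxOf e) (hL : L.Nodup) : e ∈ laterCandidates L D := by
  refine Finset.mem_image.2 ⟨⟨L.idxOf e, List.idxOf_lt_length_iff.2 he⟩,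
    Finset.mem_filter.2 ⟨Finset.mem_univ _, fun j hj => ?_⟩, by simp⟩
  have := h _ hj (List.get_mem _ _)
  rw [Fin.lt_def]
  simpa [List.Nodup.idxOf_getElem hL] using this

/-- A search along a list of candidates reaches `K` as soon as `K` is obtained by removing
candidates only, and is maximal among the sets that pass the test. -/
lemma mem_searchRemovals_laterCandidates {C : Finset V} {test : Finset V → Prop}
    [DecidablePred test] {L : List V} (hL : L.Nodup) {K : Finset V} (hKC : K ⊆ C) (hK : test K)
    (hmax : ∀ X, K ⊂ X → X ⊆ C → ¬ test X) (hsub : ∀ u ∈ C \ K, u ∈ L) :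
    K ∈ searchRemovals C test (laterCandidates L) {∅} ∅ := by
  -- The path adds the elements of `C \ K` in list order, so `D` is always an initial segment of `C
  -- \ K`.
  refine mem_searchRemovals (fun D => D ⊆ C \ K ∧
    ∀ x ∈ D, ∀ y ∈ C \ K, L.idxOf y < L.idxOf x → y ∈ D) ?_ ?_
    (Or.inr ⟨∅, Finset.mem_singleton_self _, Finset.empty_subset _, by simp⟩)
  · rintro D ⟨hD, -⟩ ht
    by_contra hne
    have hK' : K ⊆ C \ D := fun v hv => Finset.mem_sdiff.2
      ⟨hKC hv, fun h => (Finset.mem_sdiff.1 (hD h)).2 hv⟩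
    exact hmax _ (hK'.ssubset_of_ne (Ne.symm hne)) Finset.sdiff_subset ht
  · rintro D ⟨hD, hcl⟩ ht
    have hne : ((C \ K) \ D).Nonempty := by
      rw [Finset.nonempty_iff_ne_empty, Ne, Finset.sdiff_eq_empty_iff_subset]
      intro h
      rw [hD.antisymm h, Finset.sdiff_sdiff_eq_self hKC] at ht
      exact ht hK
    -- The next vertex is the earliest missing one; since `D` is an initial segment, all of `D`
    -- precedes it and `laterCandidates` offers it.
    obtain ⟨e, he, hmin⟩ := Finset.exists_min_image _ L.idxOf hne
    obtain ⟨heC, heD⟩ := Finset.mem_sdiff.1 he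
    refine ⟨e, mem_laterCandidates (hsub e heC) (fun x hx hxL => ?_) hL,
      Finset.mem_sdiff.2 ⟨(Finset.mem_sdiff.1 heC).1, heD⟩, ?_, ?_⟩
    · by_contra hlt
      rcases (not_lt.1 hlt).lt_or_eq with h | h
      · exact heD (hcl x hx e heC h)
      · exact heD ((List.idxOf_inj (hsub e heC)).1 h ▸ hx)
    · exact Finset.insert_subset heC hD
    · intro x hx y hy hlt
      rw [Finset.mem_insert] at hx ⊢
      rcases hx with rfl | hx
      · by_contra hy'
        rw [not_or] at hy'
        exact absurd (hmin y (Finset.mem_sdiff.2 ⟨hy, hy'.2⟩)) (not_le.2 hlt)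
      · exact Or.inr (hcl x hx y hy hlt)

end Removal

/-! ### The counting argument for the average types -/

/-- If sufficiently many members of `K` have a high score, then the total score of `K` is too high
for `K` to be isolated. -/
lemma le_sum_of_many_high {V : Type*} [DecidableEq V] {K T : Finset V} {s : V → ℕ} {w c δ : ℚ}
    (hw : 0 ≤ w) (hTK : T ⊆ K) (hlow : ∀ v ∈ K, w * δ ≤ s v)
    (hhigh : ∀ v ∈ T, w * (2 * K.card + c) ≤ s v) (hcard : δ - c + 1 ≤ K.card)
    (hT : (K.card : ℚ) - 1 + c - δ ≤ T.card) :
    w * K.card * ((K.card : ℚ) - 1 + c) ≤ ∑ v ∈ K, (s v : ℚ) := by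
  rw [← Finset.sum_sdiff hTK]
  have h1 : (T.card : ℚ) * (w * (2 * K.card + c)) ≤ ∑ v ∈ T, (s v : ℚ) := by
    rw [← nsmul_eq_mul]
    exact Finset.card_nsmul_le_sum _ _ _ hhigh
  have h2 : ((K.card : ℚ) - T.card) * (w * δ) ≤ ∑ v ∈ K \ T, (s v : ℚ) := by
    have : ((K \ T).card : ℚ) = K.card - T.card := by
      rw [← Finset.card_sdiff_add_card_eq_card hTK]; push_cast; ring
    rw [← this, ← nsmul_eq_mul]
    exact Finset.card_nsmul_le_sum _ _ _ fun v hv => hlow v (Finset.mem_sdiff.1 hv).1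
  have hm : (0 : ℚ) ≤ K.card := Nat.cast_nonneg _
  -- After cancelling `w|K|δ`, this is the required inequality without the factor `w`. It goes
  -- through `|T| |K|`: `hcard` gives `2|K| + c - δ ≥ |K|`, and `hT` bounds `|T|`.
  have h3 : (K.card : ℚ) * ((K.card : ℚ) - 1 + c - δ) ≤ T.card * (2 * K.card + c - δ) := by
    have h4 : (K.card : ℚ) * ((K.card : ℚ) - 1 + c - δ) ≤ K.card * T.card :=
      mul_le_mul_of_nonneg_left hT hm
    have h5 : (T.card : ℚ) * K.card ≤ T.card * (2 * K.card + c - δ) :=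
      mul_le_mul_of_nonneg_left (by linarith) (Nat.cast_nonneg _)
    linarith
  have h6 := mul_le_mul_of_nonneg_left h3 hw
  linarith

lemma le_removalBound {V : Type*} (c : ℚ) (δ : ℕ) (C : Finset V) :
    (C.card : ℚ) - δ + c - 2 ≤ removalBound c δ C := by
  have h1 := Int.le_ceil ((C.card : ℚ) - δ + c - 2)
  have h2 : ((⌈(C.card : ℚ) - δ + c - 2⌉ : ℤ) : ℚ) ≤ ((removalBound c δ C : ℤ) : ℚ) :=
    Int.cast_le.2 (Int.self_le_toNat _)
  exact_mod_cast h1.trans h2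

/-- A vertex outside of the list of the top vertices, but of a high score, is impossible if enough
of the top vertices belong to an isolated set. -/
lemma le_sum_of_notMem_topList {V : Type*} [DecidableEq V] (pick : ChoiceRule V) {K X : Finset V}
    {s : V → ℕ} {w c δ : ℚ} (hw : 0 ≤ w) (hlow : ∀ v ∈ K, w * δ ≤ s v)
    (hcard : δ - c + 1 ≤ K.card) {d r : ℕ} {u : V} (hu : u ∈ X) (hu' : u ∉ topList pick s d X)
    (hhigh : w * (2 * K.card + c) ≤ s u) (hr : ((topList pick s d X).toFinset \ K).card ≤ r)
    (hd : (K.card : ℚ) + r - 1 + c - δ ≤ d) :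
    w * K.card * ((K.card : ℚ) - 1 + c) ≤ ∑ v ∈ K, (s v : ℚ) := by
  -- As `u` was left out, the list has exactly `d` members; at most `r` lie outside `K`, and those
  -- inside score at least as high as `u`.
  refine le_sum_of_many_high (T := (topList pick s d X).toFinset ∩ K) hw
    Finset.inter_subset_right hlow (fun v hv => hhigh.trans ?_) hcard ?_
  · exact_mod_cast le_of_mem_topList pick s hu hu'
      (List.mem_toFinset.1 (Finset.mem_inter.1 hv).1)
  · have h1 := Finset.card_sdiff_add_card_inter (topList pick s d X).toFinset K
    rw [card_toFinset_topList pick s hu hu'] at h1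
    have h2 : (d : ℚ) ≤ r + ((topList pick s d X).toFinset ∩ K).card := by
      exact_mod_cast (by omega : d ≤ r + ((topList pick s d X).toFinset ∩ K).card)
    linarith

/-- The vertices outside of a maximal set among those of low total score are top vertices. -/
lemma mem_topList_of_maximal {V : Type*} [DecidableEq V] (pick : ChoiceRule V) {C K : Finset V}
    {s : V → ℕ} {w c : ℚ} {δ : ℕ} (hw : 0 ≤ w) (hKC : K ⊆ C) (hlow : ∀ v ∈ K, w * δ ≤ s v)
    (hcard : (δ : ℚ) - c + 1 ≤ K.card)
    (hK : ∑ v ∈ K, (s v : ℚ) < w * K.card * ((K.card : ℚ) - 1 + c))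
    (hmax : ∀ X, K ⊂ X → X ⊆ C →
      w * X.card * ((X.card : ℚ) - 1 + c) ≤ ∑ v ∈ X, (s v : ℚ)) {u : V} (hu : u ∈ C \ K) :
    u ∈ topList pick s (removalBound c δ C) C := by
  by_contra hu'
  obtain ⟨huC, huK⟩ := Finset.mem_sdiff.1 hu
  refine absurd hK (not_lt.2 ?_)
  -- The omitted `u` is itself outside `K`, so at most `|C \ K| - 1` listed vertices are; this
  -- saving of one matches the constant in `removalBound`.
  refine le_sum_of_notMem_topList pick (r := ((C \ K).erase u).card) hw hlow hcard huC hu' ?_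
    (Finset.card_le_card fun v hv => ?_) ?_
  · have h := hmax (insert u K) (Finset.ssubset_insert huK) (Finset.insert_subset huC hKC)
    rw [Finset.sum_insert huK, Finset.card_insert_of_notMem huK] at h
    push_cast at h
    linarith
  · obtain ⟨hv1, hv2⟩ := Finset.mem_sdiff.1 hv
    rw [List.mem_toFinset] at hv1
    exact Finset.mem_erase.2 ⟨fun h => hu' (h ▸ hv1), Finset.mem_sdiff.2
      ⟨mem_of_mem_topList pick s hv1, hv2⟩⟩
  · have h1 := Finset.card_erase_add_one hu
    have h2 := Finset.card_sdiff_add_card_eq_card hKC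
    have h3 : (((C \ K).erase u).card : ℚ) + 1 + K.card = C.card := by
      exact_mod_cast (by omega : ((C \ K).erase u).card + 1 + K.card = C.card)
    have := le_removalBound c δ C
    linarith

/-! ### Isolation in temporal graphs via scores -/

lemma cast_sup_lt_iff {ι : Type*} {s : Finset ι} (hs : s.Nonempty) (f : ι → ℕ) (x : ℚ) :
    ((s.sup f : ℕ) : ℚ) < x ↔ ∀ i ∈ s, (f i : ℚ) < x := by
  constructor
  · intro h i hi
    exact lt_of_le_of_lt (by exact_mod_cast Finset.le_sup (f := f) hi) h
  · intro h
    obtain ⟨i, hi, h'⟩ := Finset.exists_mem_eq_sup s hs f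
    rw [h']
    exact h i hi

namespace TemporalGraph

section

variable {V : Type*} {𝒢 : TemporalGraph V}

lemma isClique_inter_iff {C : Finset V} {a b : ℕ} :
    (𝒢.inter a b).IsClique (C : Set V) ↔
      ∀ t ∈ Finset.Icc a b, (𝒢.layer t).IsClique (C : Set V) := by
  constructor
  · intro h t ht u hu v hv huv
    exact (h hu hv huv).2 t ht
  · intro h u hu v hv huv
    exact ⟨huv, fun t ht => h t ht hu hv huv⟩

lemma IsTemporalClique.isClique_inter {C : Finset V} {a b : ℕ}
    (h : 𝒢.IsTemporalClique C a b) : (𝒢.inter a b).IsClique (C : Set V) :=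
  isClique_inter_iff.2 h.2.2

lemma IsTemporalClique.anti {C X : Finset V} {a b : ℕ} (h : 𝒢.IsTemporalClique C a b)
    (hX : X.Nonempty) (hXC : X ⊆ C) : 𝒢.IsTemporalClique X a b :=
  ⟨hX, h.2.1, fun t ht => (h.2.2 t ht).subset (Finset.coe_subset.2 hXC)⟩

lemma not_nonempty_violatedLayers_iff [Fintype V] {c : ℚ} {C : Finset V} {a b : ℕ} :
    ¬ (𝒢.violatedLayers c a b C).Nonempty ↔ ∀ i ∈ Finset.Icc a b,
      ∑ v ∈ C, ((𝒢.layer i).degree v : ℚ) < C.card * ((C.card : ℚ) - 1 + c) := by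
  rw [Finset.not_nonempty_iff_eq_empty, violatedLayers, Finset.filter_eq_empty_iff]
  push_cast
  simp only [not_le]

end

section

variable {V : Type*} [Fintype V] [DecidableEq V] {𝒢 : TemporalGraph V}

/-- The vertex score by which the algorithm for the isolation type `I` proceeds. -/
def score (𝒢 : TemporalGraph V) (I : IsolationType) (a b : ℕ) : V → ℕ :=
  match I with
  | .maxUsually | .usuallyAvg => 𝒢.sumDegree a b
  | _ => 𝒢.maxDegree a b

/-- The number of layers that are summed up in the score for the isolation type `I`. -/
def scoreWeight (I : IsolationType) (a b : ℕ) : ℚ :=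
  match I with
  | .maxUsually | .usuallyAvg => (b : ℚ) - a + 1
  | _ => 1

lemma scoreWeight_pos (I : IsolationType) {a b : ℕ} (hab : a ≤ b) : 0 < scoreWeight I a b := by
  have : (a : ℚ) ≤ b := by exact_mod_cast hab
  cases I <;> simp only [scoreWeight] <;> linarith

lemma cast_card_Icc {a b : ℕ} (hab : a ≤ b) : ((Finset.Icc a b).card : ℚ) = (b : ℚ) - a + 1 := by
  rw [Nat.card_Icc, Nat.cast_sub (by omega)]
  push_cast
  ring

lemma degree_inter_le {a b i : ℕ} (hi : i ∈ Finset.Icc a b) (v : V) :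
    (𝒢.inter a b).degree v ≤ (𝒢.layer i).degree v := by
  rw [← SimpleGraph.card_neighborFinset_eq_degree, ← SimpleGraph.card_neighborFinset_eq_degree]
  refine Finset.card_le_card fun u hu => ?_
  rw [SimpleGraph.mem_neighborFinset] at hu ⊢
  exact hu.2 i hi

lemma scoreWeight_mul_degree_le (I : IsolationType) {a b : ℕ} (hab : a ≤ b) (v : V) :
    scoreWeight I a b * (𝒢.inter a b).degree v ≤ 𝒢.score I a b v := by
  have h1 : ((𝒢.inter a b).degree v : ℚ) ≤ 𝒢.maxDegree a b v := by
    have ha : a ∈ Finset.Icc a b := Finset.left_mem_Icc.2 hab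
    exact_mod_cast (degree_inter_le ha v).trans
      (Finset.le_sup (f := fun i => (𝒢.layer i).degree v) ha)
  have h2 : ((b : ℚ) - a + 1) * (𝒢.inter a b).degree v ≤ 𝒢.sumDegree a b v := by
    rw [← cast_card_Icc hab]
    have := Finset.card_nsmul_le_sum (Finset.Icc a b) (fun i => (𝒢.layer i).degree v) _
      fun i hi => degree_inter_le (𝒢 := 𝒢) hi v
    rw [smul_eq_mul] at this
    exact_mod_cast this
  cases I <;> simp only [scoreWeight, score, one_mul] <;> assumption

/-- Out-degree and degree differ by the same constant in every layer, so comparing at the two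
maximizing layers suffices. -/
lemma sup_outdeg_add_card {C : Finset V} {a b : ℕ} (h : 𝒢.IsTemporalClique C a b) {v : V}
    (hv : v ∈ C) :
    ((Finset.Icc a b).sup fun i => outdeg (𝒢.layer i) v C) + C.card = 𝒢.maxDegree a b v + 1 := by
  have hne : (Finset.Icc a b).Nonempty := Finset.nonempty_Icc.2 h.2.1.2.1
  have key := fun i hi => outdeg_add_card (𝒢.layer i) (h.2.2 i hi) hv
  obtain ⟨i, hi, hi'⟩ := Finset.exists_mem_eq_sup _ hne fun i => outdeg (𝒢.layer i) v C
  obtain ⟨j, hj, hj'⟩ := Finset.exists_mem_eq_sup _ hne fun i => (𝒢.layer i).degree v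
  have h1 := Finset.le_sup (f := fun i => outdeg (𝒢.layer i) v C) hj
  have h2 := Finset.le_sup (f := fun i => (𝒢.layer i).degree v) hi
  have h3 := key i hi
  have h4 := key j hj
  unfold maxDegree
  omega

lemma cast_sup_outdeg {C : Finset V} {a b : ℕ} (h : 𝒢.IsTemporalClique C a b) {v : V}
    (hv : v ∈ C) :
    (((Finset.Icc a b).sup fun i => outdeg (𝒢.layer i) v C : ℕ) : ℚ)
      = 𝒢.maxDegree a b v - (C.card - 1) := by
  have h1 : (((Finset.Icc a b).sup fun i => outdeg (𝒢.layer i) v C : ℕ) : ℚ) + C.card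
      = 𝒢.maxDegree a b v + 1 := by exact_mod_cast sup_outdeg_add_card h hv
  linarith

lemma cast_sum_outdeg {C : Finset V} {a b : ℕ} (h : 𝒢.IsTemporalClique C a b) {v : V}
    (hv : v ∈ C) :
    ((∑ i ∈ Finset.Icc a b, outdeg (𝒢.layer i) v C : ℕ) : ℚ)
      = 𝒢.sumDegree a b v - ((b : ℚ) - a + 1) * (C.card - 1) := by
  unfold sumDegree
  push_cast
  rw [Finset.sum_congr rfl fun i hi => outdeg_eq_cast (𝒢.layer i) (h.2.2 i hi) hv,
    Finset.sum_sub_distrib, Finset.sum_const, nsmul_eq_mul, cast_card_Icc h.2.1.2.1]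

lemma isolated_iff_forall_score {I : IsolationType} (hI : I = .alltimeMax ∨ I = .maxUsually)
    {c : ℚ} {C : Finset V} {a b : ℕ} (h : 𝒢.IsTemporalClique C a b) :
    𝒢.Isolated I c C a b ↔
      ∀ v ∈ C, (𝒢.score I a b v : ℚ) < scoreWeight I a b * ((C.card : ℚ) - 1 + c) := by
  rcases hI with rfl | rfl
  · simp only [Isolated, score, scoreWeight]
    rw [cast_sup_lt_iff h.1]
    refine forall₂_congr fun v hv => ?_
    rw [cast_sup_outdeg h hv]
    constructor <;> intro h <;> linarith
  · simp only [Isolated, score, scoreWeight]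
    rw [cast_sup_lt_iff h.1]
    refine forall₂_congr fun v hv => ?_
    rw [cast_sum_outdeg h hv]
    constructor <;> intro h <;> linarith

lemma isolated_iff_sum_score {I : IsolationType} (hI : I = .avgAlltime ∨ I = .usuallyAvg)
    {c : ℚ} {C : Finset V} {a b : ℕ} (h : 𝒢.IsTemporalClique C a b) :
    𝒢.Isolated I c C a b ↔
      ∑ v ∈ C, (𝒢.score I a b v : ℚ) < scoreWeight I a b * C.card * ((C.card : ℚ) - 1 + c) := by
  rcases hI with rfl | rfl
  · simp only [Isolated, score, scoreWeight]
    rw [Nat.cast_sum, Finset.sum_congr rfl fun v hv => cast_sup_outdeg h hv,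
      Finset.sum_sub_distrib, Finset.sum_const, nsmul_eq_mul]
    constructor <;> intro h <;> linarith
  · simp only [Isolated, score, scoreWeight]
    rw [Finset.sum_comm, Nat.cast_sum, Finset.sum_congr rfl fun v hv => cast_sum_outdeg h hv,
      Finset.sum_sub_distrib, Finset.sum_const, nsmul_eq_mul]
    constructor <;> intro h <;> linarith

lemma isolated_alltimeAvg_iff {c : ℚ} {C : Finset V} {a b : ℕ}
    (h : 𝒢.IsTemporalClique C a b) :
    𝒢.Isolated .alltimeAvg c C a b ↔ ∀ i ∈ Finset.Icc a b,
      ∑ v ∈ C, ((𝒢.layer i).degree v : ℚ) < C.card * ((C.card : ℚ) - 1 + c) := by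
  simp only [Isolated]
  rw [cast_sup_lt_iff (Finset.nonempty_Icc.2 h.2.1.2.1)]
  refine forall₂_congr fun i hi => ?_
  exact avgIsolated_iff (𝒢.layer i) (h.2.2 i hi)

/-- This is the link from temporal isolation to trimming: each score is at least the weight times
the degree in `G_∩`, and the weight is positive, so it cancels. -/
lemma IsIsolatedClique.avgIsolated_inter {I : IsolationType} (hI : I ≠ .usuallyMax) {c : ℚ}
    {C : Finset V} {a b : ℕ} (h : 𝒢.IsIsolatedClique I c C a b) :
    AvgIsolated (𝒢.inter a b) c C := by
  obtain ⟨hC, hiso⟩ := h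
  have hab := hC.2.1.2.1
  rw [avgIsolated_iff _ hC.isClique_inter]
  have hw := scoreWeight_pos I hab
  have hs := fun v => scoreWeight_mul_degree_le (𝒢 := 𝒢) I hab v
  have hmax : (I = .alltimeMax ∨ I = .maxUsually) → ∑ v ∈ C, ((𝒢.inter a b).degree v : ℚ) <
      C.card * ((C.card : ℚ) - 1 + c) := by
    intro h
    rw [isolated_iff_forall_score h hC] at hiso
    rw [← nsmul_eq_mul, ← Finset.sum_const]
    exact Finset.sum_lt_sum_of_nonempty hC.1 fun v hv =>
      lt_of_mul_lt_mul_left ((hs v).trans_lt (hiso v hv)) hw.le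
  have hsum : (I = .avgAlltime ∨ I = .usuallyAvg) → ∑ v ∈ C, ((𝒢.inter a b).degree v : ℚ) <
      C.card * ((C.card : ℚ) - 1 + c) := by
    intro h
    rw [isolated_iff_sum_score h hC, mul_assoc] at hiso
    refine lt_of_mul_lt_mul_left (lt_of_le_of_lt ?_ hiso) hw.le
    rw [Finset.mul_sum]
    exact Finset.sum_le_sum fun v _ => hs v
  cases I with
  | alltimeAvg =>
    -- Any single layer of the window would do.
    have ha : a ∈ Finset.Icc a b := Finset.left_mem_Icc.2 hab
    refine lt_of_le_of_lt ?_ ((isolated_alltimeAvg_iff hC).1 hiso a ha)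
    exact Finset.sum_le_sum fun v _ => by exact_mod_cast degree_inter_le ha v
  | alltimeMax => exact hmax (Or.inl rfl)
  | avgAlltime => exact hsum (Or.inl rfl)
  | maxUsually => exact hmax (Or.inr rfl)
  | usuallyAvg => exact hsum (Or.inr rfl)
  | usuallyMax => exact absurd rfl hI

/-! ### Correctness of the enumeration of isolated subsets -/

lemma isIsolatedClique_of_mem_greedyRemoval {I : IsolationType}
    (hI : I = .alltimeMax ∨ I = .maxUsually) {pick : ChoiceRule V} {c : ℚ} {C X : Finset V}
    {a b δ : ℕ} (hC : 𝒢.IsTemporalClique C a b)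
    (hX : X ∈ greedyRemoval pick (sizeBound c δ) (𝒢.score I a b)
      (fun n => scoreWeight I a b * ((n : ℚ) - 1 + c)) C) : 𝒢.IsIsolatedClique I c X a b := by
  obtain ⟨hXC, hk, hlt⟩ := greedyRemoval_sound pick hX
  have hne : X.Nonempty := by
    have : (1 : ℤ) ≤ X.card := (le_max_left _ _).trans hk
    exact Finset.card_pos.1 (by exact_mod_cast this)
  exact ⟨hC.anti hne hXC, (isolated_iff_forall_score hI (hC.anti hne hXC)).2 hlt⟩

lemma isIsolatedClique_of_mem_searchRemovals {I : IsolationType}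
    (hI : I = .avgAlltime ∨ I = .usuallyAvg) {c : ℚ} {C X : Finset V} {a b : ℕ}
    (hC : 𝒢.IsTemporalClique C a b) {branch : Finset V → Finset V}
    (hX : X ∈ searchRemovals C (fun C' => ¬ scoreWeight I a b * C'.card * ((C'.card : ℚ) - 1 + c)
      ≤ ((∑ v ∈ C', 𝒢.score I a b v : ℕ) : ℚ)) branch {∅} ∅) :
    𝒢.IsIsolatedClique I c X a b := by
  obtain ⟨hXC, ht⟩ := (searchRemovals_sound hX).resolve_left (Finset.notMem_empty _)
  have hne : X.Nonempty := by
    rw [Finset.nonempty_iff_ne_empty]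
    -- The empty set fails the test because both sides are zero.
    rintro rfl
    simp at ht
  push_cast at ht
  exact ⟨hC.anti hne hXC, (isolated_iff_sum_score hI (hC.anti hne hXC)).2 (not_le.1 ht)⟩

lemma isIsolatedClique_of_mem_isolatedSubsets {I : IsolationType} (hI : I ≠ .usuallyMax)
    {pick : ChoiceRule V} {c : ℚ} {C X : Finset V} {a b δ : ℕ} (hC : 𝒢.IsTemporalClique C a b)
    (hX : X ∈ 𝒢.isolatedSubsets pick I c C a b δ) : 𝒢.IsIsolatedClique I c X a b := by
  cases I with
  | alltimeAvg =>
    obtain ⟨hXC, ht⟩ := (searchRemovals_sound hX).resolve_left (Finset.notMem_empty _)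
    rw [not_nonempty_violatedLayers_iff] at ht
    have hne : X.Nonempty := by
      rw [Finset.nonempty_iff_ne_empty]
      rintro rfl
      simpa using ht a (Finset.left_mem_Icc.2 hC.2.1.2.1)
    exact ⟨hC.anti hne hXC, (isolated_alltimeAvg_iff (hC.anti hne hXC)).2 ht⟩
  | alltimeMax =>
    refine isIsolatedClique_of_mem_greedyRemoval (Or.inl rfl) hC (pick := pick) (δ := δ) ?_
    simpa only [isolatedSubsets, alltimeMaxSubsets, score, scoreWeight, one_mul] using hX
  | avgAlltime =>
    refine isIsolatedClique_of_mem_searchRemovals (Or.inl rfl) hC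
      (branch := laterCandidates (topList pick (𝒢.maxDegree a b) (removalBound c δ C) C)) ?_
    simpa only [isolatedSubsets, avgAlltimeSubsets, score, scoreWeight, one_mul] using hX
  | maxUsually => exact isIsolatedClique_of_mem_greedyRemoval (Or.inr rfl) hC hX
  | usuallyAvg => exact isIsolatedClique_of_mem_searchRemovals (Or.inr rfl) hC hX
  | usuallyMax => exact absurd rfl hI

/-- Every nonempty subset of the clique `C` is again a temporal clique, so vertex-maximality of `K`
becomes maximality among the subsets of `C` that obey the score condition. -/
lemma mem_greedyRemoval_of_vertexMaximal {I : IsolationType}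
    (hI : I = .alltimeMax ∨ I = .maxUsually) (pick : ChoiceRule V) {c : ℚ} {C K : Finset V}
    {a b δ : ℕ} (hC : 𝒢.IsTemporalClique C a b) (hKC : K ⊆ C)
    (hK : 𝒢.IsIsolatedClique I c K a b) (hmax : 𝒢.VertexMaximal I c K a b)
    (hcard : (δ : ℚ) - c + 1 < K.card) :
    K ∈ greedyRemoval pick (sizeBound c δ) (𝒢.score I a b)
      (fun n => scoreWeight I a b * ((n : ℚ) - 1 + c)) C := by
  have hw := scoreWeight_pos I hC.2.1.2.1
  refine mem_greedyRemoval pick ?_ hKC (max_le ?_ (floor_le_card hcard))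
    ((isolated_iff_forall_score hI hK.1).1 hK.2) ?_
  · intro m n hmn
    have : (m : ℚ) ≤ n := by exact_mod_cast hmn
    exact mul_le_mul_of_nonneg_left (by linarith) hw.le
  · exact_mod_cast hK.1.1.card_pos
  · intro X hKX hXC hX
    have hX' := hC.anti (hK.1.1.mono hKX.1) hXC
    exact hmax ⟨X, ⟨hX', (isolated_iff_forall_score hI hX').2 hX⟩, hKX⟩

lemma mem_searchRemovals_of_vertexMaximal {I : IsolationType}
    (hI : I = .avgAlltime ∨ I = .usuallyAvg) (pick : ChoiceRule V) {c : ℚ} {C K : Finset V}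
    {a b δ : ℕ} (hC : 𝒢.IsTemporalClique C a b) (hKC : K ⊆ C)
    (hK : 𝒢.IsIsolatedClique I c K a b) (hmax : 𝒢.VertexMaximal I c K a b)
    (hδ : ∀ u ∈ K, δ ≤ (𝒢.inter a b).degree u) (hcard : (δ : ℚ) - c + 1 < K.card) :
    K ∈ searchRemovals C (fun C' => ¬ scoreWeight I a b * C'.card * ((C'.card : ℚ) - 1 + c)
      ≤ ((∑ v ∈ C', 𝒢.score I a b v : ℕ) : ℚ))
      (laterCandidates (topList pick (𝒢.score I a b) (removalBound c δ C) C)) {∅} ∅ := by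
  have hab := hC.2.1.2.1
  have hw := scoreWeight_pos I hab
  have hK' := (isolated_iff_sum_score hI hK.1).1 hK.2
  have hmax' : ∀ X, K ⊂ X → X ⊆ C → scoreWeight I a b * X.card * ((X.card : ℚ) - 1 + c)
      ≤ ∑ v ∈ X, (𝒢.score I a b v : ℚ) := by
    intro X hKX hXC
    have hX := hC.anti (hK.1.1.mono hKX.1) hXC
    by_contra hlt
    exact hmax ⟨X, ⟨hX, (isolated_iff_sum_score hI hX).2 (not_le.1 hlt)⟩, hKX⟩
  refine mem_searchRemovals_laterCandidates (nodup_topList _ _ _ _) hKC ?_ ?_ fun u hu => ?_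
  · push_cast
    exact not_le.2 hK'
  · push_cast
    exact fun X hKX hXC => not_not.2 (hmax' X hKX hXC)
  · refine mem_topList_of_maximal pick hw.le hKC (fun v hv => ?_) hcard.le hK' hmax' hu
    refine le_trans ?_ (scoreWeight_mul_degree_le I hab v)
    exact mul_le_mul_of_nonneg_left (by exact_mod_cast hδ v hv) hw.le

/-- The violated layer changes with `D`, so no fixed list contains all of `C \ K`. It is enough that
at each `D ⊆ C \ K` some top vertex of that layer lies outside `K`. -/
lemma mem_alltimeAvgSubsets_of_vertexMaximal (pick : ChoiceRule V) {c : ℚ} {C K : Finset V}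
    {a b δ : ℕ} (hC : 𝒢.IsTemporalClique C a b) (hKC : K ⊆ C)
    (hK : 𝒢.IsIsolatedClique .alltimeAvg c K a b) (hmax : 𝒢.VertexMaximal .alltimeAvg c K a b)
    (hδ : ∀ u ∈ K, δ ≤ (𝒢.inter a b).degree u) (hcard : (δ : ℚ) - c + 1 < K.card) :
    K ∈ 𝒢.alltimeAvgSubsets pick c C a b δ := by
  have hK' := (isolated_alltimeAvg_iff hK.1).1 hK.2
  have hsub : ∀ D, D ⊆ C \ K → K ⊆ C \ D := fun D hD v hv =>
    Finset.mem_sdiff.2 ⟨hKC hv, fun h => (Finset.mem_sdiff.1 (hD h)).2 hv⟩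
  refine mem_searchRemovals (fun D => D ⊆ C \ K) ?_ ?_
    (Or.inr ⟨∅, Finset.mem_singleton_self _, Finset.empty_subset _⟩)
  · intro D hD ht
    rw [not_nonempty_violatedLayers_iff] at ht
    by_contra hne
    have hX := hC.anti (hK.1.1.mono (hsub D hD)) (Finset.sdiff_subset (t := D))
    exact hmax ⟨_, ⟨hX, (isolated_alltimeAvg_iff hX).2 ht⟩,
      (hsub D hD).ssubset_of_ne (Ne.symm hne)⟩
  · intro D hD ht
    rw [not_not] at ht
    have hKD : K ⊂ C \ D := (hsub D hD).ssubset_of_ne fun h => by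
      rw [← h] at ht
      exact not_nonempty_violatedLayers_iff.2 hK' ht
    obtain ⟨hi, hviol⟩ := Finset.mem_filter.1 (Finset.min'_mem _ ht)
    set i := (𝒢.violatedLayers c a b (C \ D)).min' ht with hi_def
    have hcardD : (K.card : ℚ) + 1 ≤ (C \ D).card := by exact_mod_cast Finset.card_lt_card hKD
    simp only [dif_pos ht]
    rw [← hi_def, if_pos (by linarith)]
    by_contra hno
    have hnot : ∀ u ∈ (C \ D) \ K,
        u ∉ topList pick (fun v => (𝒢.layer i).degree v) (removalBound c δ C) (C \ D) := by
      intro u hu htop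
      obtain ⟨hu1, hu2⟩ := Finset.mem_sdiff.1 hu
      exact hno ⟨u, List.mem_toFinset.2 htop, hu1, Finset.insert_subset
        (Finset.mem_sdiff.2 ⟨(Finset.mem_sdiff.1 hu1).1, hu2⟩) hD⟩
    have hsdiff := Finset.card_sdiff_add_card_eq_card hKD.1
    have hsdiff' : ((((C \ D) \ K).card : ℕ) : ℚ) + K.card = (C \ D).card := by
      exact_mod_cast hsdiff
    -- With `n = |C \ D|` and `k = |K|`, the layer sums of `C \ D` and `K` differ by more than
    -- `n(n-1+c) - k(k-1+c) = (n-k)(n+k-1+c) ≥ (n-k)(2k+c)`, so some vertex outside `K` has degree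
    -- at least `2k + c`.
    obtain ⟨u, hu, hhigh⟩ : ∃ u ∈ (C \ D) \ K,
        (2 * K.card + c : ℚ) ≤ (𝒢.layer i).degree u := by
      by_contra! hlow
      have h1 : ∑ v ∈ (C \ D) \ K, ((𝒢.layer i).degree v : ℚ)
          ≤ ((C \ D) \ K).card * (2 * K.card + c) := by
        rw [← nsmul_eq_mul]
        exact Finset.sum_le_card_nsmul _ _ _ fun v hv => (hlow v hv).le
      have h2 := hK' i hi
      push_cast at hviol
      rw [← Finset.sum_sdiff hKD.1, ← hsdiff'] at hviol
      nlinarith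
    refine absurd (hK' i hi) (not_lt.2 ?_)
    -- By assumption all top vertices lie in `K`, hence `r = 0`; the bound on `d` uses only `|K| + 1
    -- ≤ |C|`.
    have := le_sum_of_notMem_topList pick (K := K) (X := C \ D) (w := 1) (c := c) (δ := δ)
      (s := fun v => (𝒢.layer i).degree v) (r := 0) zero_le_one (fun v hv => ?_) hcard.le
      (Finset.mem_sdiff.1 hu).1 (hnot u hu) (by simpa using hhigh) ?_ ?_
    · simpa using this
    · rw [one_mul]
      exact_mod_cast (hδ v hv).trans (degree_inter_le hi v)
    · rw [Nat.le_zero, Finset.card_eq_zero, Finset.sdiff_eq_empty_iff_subset]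
      intro v hv
      by_contra hvK
      have hv' := List.mem_toFinset.1 hv
      exact hnot v (Finset.mem_sdiff.2 ⟨mem_of_mem_topList pick _ hv', hvK⟩) hv'
    · have h1 := le_removalBound c δ C
      have h2 : ((C \ D).card : ℚ) ≤ C.card := by
        exact_mod_cast Finset.card_le_card Finset.sdiff_subset
      push_cast
      linarith

lemma mem_isolatedSubsets_of_vertexMaximal {I : IsolationType} (hI : I ≠ .usuallyMax)
    (pick : ChoiceRule V) {c : ℚ} {C K : Finset V} {a b δ : ℕ}
    (hC : 𝒢.IsTemporalClique C a b) (hKC : K ⊆ C) (hK : 𝒢.IsIsolatedClique I c K a b)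
    (hmax : 𝒢.VertexMaximal I c K a b) (hδ : ∀ u ∈ K, δ ≤ (𝒢.inter a b).degree u)
    (hcard : (δ : ℚ) - c + 1 < K.card) : K ∈ 𝒢.isolatedSubsets pick I c C a b δ := by
  cases I with
  | alltimeAvg => exact mem_alltimeAvgSubsets_of_vertexMaximal pick hC hKC hK hmax hδ hcard
  | alltimeMax =>
    simpa only [isolatedSubsets, alltimeMaxSubsets, score, scoreWeight, one_mul] using
      mem_greedyRemoval_of_vertexMaximal (Or.inl rfl) pick hC hKC hK hmax hcard
  | avgAlltime =>
    simpa only [isolatedSubsets, avgAlltimeSubsets, score, scoreWeight, one_mul] using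
      mem_searchRemovals_of_vertexMaximal (Or.inl rfl) pick hC hKC hK hmax hδ hcard
  | maxUsually =>
    exact mem_greedyRemoval_of_vertexMaximal (Or.inr rfl) pick hC hKC hK hmax hcard
  | usuallyAvg =>
    exact mem_searchRemovals_of_vertexMaximal (Or.inr rfl) pick hC hKC hK hmax hδ hcard
  | usuallyMax => exact absurd rfl hI

/-! ### Soundness and completeness of `collectResult` -/

lemma isIsolatedClique_of_mem_collectResult {I : IsolationType} (hI : I ≠ .usuallyMax)
    {pick : ChoiceRule V} {trim : TrimmingProcedure V} {c : ℚ} {C : Finset V} {a b : ℕ}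
    (h : (C, a, b) ∈ 𝒢.collectResult pick trim I c) : 𝒢.IsIsolatedClique I c C a b := by
  simp only [collectResult, Finset.mem_biUnion, Finset.mem_image, Prod.mk.injEq] at h
  obtain ⟨a', ha, b', hb, v, -, D, hD, X, hX, rfl, rfl, rfl⟩ := h
  rw [Finset.mem_Icc] at ha hb
  have hD' := (of_mem_maximalCliques (Finset.mem_filter.1 hD).1).2
  exact isIsolatedClique_of_mem_isolatedSubsets hI
    ⟨hD'.1, ⟨ha.1, hb.1, hb.2⟩, isClique_inter_iff.1 hD'.2⟩ hX

/-- The pivot of `K` has minimum degree in `K`, so its degree serves as `δ`; the candidate set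
contains `K`, and `K` is recovered from a maximal clique `C ⊇ K` there. -/
lemma mem_collectResult_of_vertexMaximal {I : IsolationType} (hI : I ≠ .usuallyMax)
    (pick : ChoiceRule V) {trim : TrimmingProcedure V} {c : ℚ} (htrim : IsTrimming c trim)
    {K : Finset V} {a b : ℕ} (hK : 𝒢.IsIsolatedClique I c K a b)
    (hmax : 𝒢.VertexMaximal I c K a b) : (K, a, b) ∈ 𝒢.collectResult pick trim I c := by
  obtain ⟨h1, h2, h3⟩ := hK.1.2.1
  have havg := hK.avgIsolated_inter hI
  have hclique := hK.1.isClique_inter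
  obtain ⟨v, hv⟩ := exists_isPivot (sortByDegree pick (𝒢.inter a b)) hK.1.1
  have hδ : ∀ u ∈ K, (𝒢.inter a b).degree v ≤ (𝒢.inter a b).degree u := fun u hu =>
    hv.degree_le (mem_sortByDegree pick _) (pairwise_sortByDegree pick _) hu
  have hcard := havg.lt_card hclique hK.1.1 hδ
  have hsub := (htrim (𝒢.inter a b) _ (nodup_sortByDegree pick _) (mem_sortByDegree pick _)
    (pairwise_sortByDegree pick _) v).2 K hclique havg hv
  obtain ⟨C, hC, hKC⟩ := exists_mem_maximalCliques (𝒢.inter a b) hK.1.1 hsub hclique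
  have hC' := (of_mem_maximalCliques hC).2
  simp only [collectResult, Finset.mem_biUnion, Finset.mem_image, Prod.mk.injEq]
  refine ⟨a, Finset.mem_Icc.2 ⟨h1, h2.trans h3⟩, b, Finset.mem_Icc.2 ⟨h2, h3⟩, v,
    Finset.mem_univ _, C, Finset.mem_filter.2 ⟨hC, ?_⟩, K, ?_, rfl, rfl, rfl⟩
  · have hle : (K.card : ℤ) ≤ C.card := by exact_mod_cast Finset.card_le_card hKC
    exact (max_le (by exact_mod_cast hK.1.1.card_pos) (floor_le_card hcard)).trans hle
  · exact mem_isolatedSubsets_of_vertexMaximal hI pick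
      ⟨hC'.1, ⟨h1, h2, h3⟩, isClique_inter_iff.1 hC'.2⟩ hKC hK hmax hδ hcard

end

end TemporalGraph

namespace TemporalGraph

variable {V : Type*} [Fintype V] [DecidableEq V] {𝒢 : TemporalGraph V}

/-! ### Correctness of the vertex-maximality test -/

/-- Exchanging a vertex for one of at most the same score preserves isolation. -/
lemma Isolated.exchange {I : IsolationType} (hI : I ≠ .usuallyMax) (hI' : I ≠ .alltimeAvg) {c : ℚ}
    {X : Finset V} {a b : ℕ} (hX : 𝒢.IsTemporalClique X a b) (hiso : 𝒢.Isolated I c X a b)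
    {u v : V} (hv : v ∈ X) (hu : u ∉ X) (huv : 𝒢.score I a b u ≤ 𝒢.score I a b v)
    (hX' : 𝒢.IsTemporalClique (insert u (X.erase v)) a b) :
    𝒢.Isolated I c (insert u (X.erase v)) a b := by
  have hu' : u ∉ X.erase v := fun h => hu (Finset.mem_of_mem_erase h)
  have hcard : (insert u (X.erase v)).card = X.card := by
    rw [Finset.card_insert_of_notMem hu', Finset.card_erase_add_one hv]
  have huv' : (𝒢.score I a b u : ℚ) ≤ 𝒢.score I a b v := by exact_mod_cast huv
  have hmax : (I = .alltimeMax ∨ I = .maxUsually) →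
      𝒢.Isolated I c (insert u (X.erase v)) a b := by
    intro h
    rw [isolated_iff_forall_score h hX] at hiso
    rw [isolated_iff_forall_score h hX', hcard]
    intro w hw
    rcases Finset.mem_insert.1 hw with rfl | hw
    · exact huv'.trans_lt (hiso v hv)
    · exact hiso w (Finset.mem_of_mem_erase hw)
  have hsum : (I = .avgAlltime ∨ I = .usuallyAvg) →
      𝒢.Isolated I c (insert u (X.erase v)) a b := by
    intro h
    rw [isolated_iff_sum_score h hX, ← Finset.add_sum_erase _ _ hv] at hiso
    rw [isolated_iff_sum_score h hX', hcard, Finset.sum_insert hu']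
    linarith
  cases I with
  | alltimeAvg => exact absurd rfl hI'
  | alltimeMax => exact hmax (Or.inl rfl)
  | avgAlltime => exact hsum (Or.inl rfl)
  | maxUsually => exact hmax (Or.inr rfl)
  | usuallyAvg => exact hsum (Or.inr rfl)
  | usuallyMax => exact absurd rfl hI

lemma shrink_sound {pick : ChoiceRule V} {I : IsolationType} {c : ℚ} {s : V → ℕ}
    {C : Finset V} {a b : ℕ} {D : Finset V} (h : 𝒢.shrink pick I c s C a b D ≠ ∅) :
    𝒢.shrink pick I c s C a b D ⊆ D ∧
      𝒢.Isolated I c (C ∪ 𝒢.shrink pick I c s C a b D) a b := by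
  induction D using Finset.strongInduction with
  | H D ih =>
    rw [shrink] at h ⊢
    split_ifs at h ⊢ with h1 h2
    · exact ⟨Finset.Subset.refl _, h2⟩
    · have := ih _ (Finset.erase_ssubset (argmaxOf pick s D h1).2) h
      exact ⟨this.1.trans (Finset.erase_subset _ _), this.2⟩
    · exact absurd (Finset.not_nonempty_iff_eq_empty.1 h1) h

/-- Invariant: some nonempty `E ⊆ D` has `C ∪ E` isolated. If the removed top-score vertex lies in
`E`, it is exchanged for a vertex of `D \ E`, whose score is no higher. -/
lemma shrink_ne_empty (pick : ChoiceRule V) {I : IsolationType} (hI : I ≠ .usuallyMax)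
    (hI' : I ≠ .alltimeAvg) {c : ℚ} {C : Finset V} {a b : ℕ} {D E : Finset V}
    (hCD : 𝒢.IsTemporalClique (C ∪ D) a b) (hdisj : Disjoint C D) (hE : E.Nonempty) (hED : E ⊆ D)
    (hiso : 𝒢.Isolated I c (C ∪ E) a b) :
    𝒢.shrink pick I c (𝒢.score I a b) C a b D ≠ ∅ := by
  induction D using Finset.strongInduction generalizing E with
  | H D ih =>
    have hD := hE.mono hED
    rw [shrink, dif_pos hD]
    split_ifs with h2
    · exact hD.ne_empty
    · set v := (argmaxOf pick (𝒢.score I a b) D hD).1 with hv_def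
      have hvD : v ∈ D := (argmaxOf pick (𝒢.score I a b) D hD).2
      have key : ∀ F : Finset V, F.Nonempty → F ⊆ D.erase v → 𝒢.Isolated I c (C ∪ F) a b →
          𝒢.shrink pick I c (𝒢.score I a b) C a b (D.erase v) ≠ ∅ := by
        intro F hF hFD hF'
        refine ih _ (Finset.erase_ssubset hvD) (hCD.anti ?_ ?_)
          (hdisj.mono_right (Finset.erase_subset _ _)) hF hFD hF'
        · exact (hF.mono hFD).mono Finset.subset_union_right
        · exact Finset.union_subset_union_right (Finset.erase_subset _ _)
      by_cases hvE : v ∈ E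
      -- Otherwise `E = D`, and the loop would already have stopped.
      · obtain ⟨u, huD, huE⟩ : ∃ u ∈ D, u ∉ E := by
          by_contra! h
          exact h2 ((hED.antisymm h) ▸ hiso)
        have huv : u ≠ v := fun h => huE (h ▸ hvE)
        have hvC : v ∉ C := fun h => Finset.disjoint_left.1 hdisj h hvD
        have huC : u ∉ C := fun h => Finset.disjoint_left.1 hdisj h huD
        refine key (insert u (E.erase v)) (Finset.insert_nonempty _ _)
          (Finset.insert_subset (Finset.mem_erase.2 ⟨huv, huD⟩)
            (Finset.erase_subset_erase _ hED)) ?_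
        have heq : C ∪ insert u (E.erase v) = insert u ((C ∪ E).erase v) := by
          rw [Finset.union_insert, Finset.erase_union_distrib, Finset.erase_eq_of_notMem hvC]
        have hsub : C ∪ insert u (E.erase v) ⊆ C ∪ D := Finset.union_subset_union_right
          (Finset.insert_subset huD ((Finset.erase_subset _ _).trans hED))
        have hcl := hCD.anti (Finset.Nonempty.inr (Finset.insert_nonempty u (E.erase v))) hsub
        rw [heq] at hcl ⊢
        exact Isolated.exchange hI hI'
          (hCD.anti (hE.mono Finset.subset_union_right) (Finset.union_subset_union_right hED))
          hiso (Finset.mem_union_right _ hvE)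
          (fun h => (Finset.mem_union.1 h).elim huC huE)
          (le_argmaxOf pick (𝒢.score I a b) D hD huD) hcl
      · exact key E hE (fun x hx => Finset.mem_erase.2 ⟨fun h => hvE (h ▸ hx), hED hx⟩) hiso

/-- The searched set consists of exactly the vertices that extend `C` to a larger clique of `G_∩`;
the choice of `w` does not affect it. So a larger clique is `C ∪ E` with `E` inside one of the
maximal cliques `D`. -/
lemma vertexMaximalBySearch_iff (pick : ChoiceRule V) {I : IsolationType} (hI : I ≠ .usuallyMax)
    (hI' : I ≠ .alltimeAvg) {c : ℚ} {C : Finset V} {a b : ℕ}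
    (hC : 𝒢.IsTemporalClique C a b) :
    𝒢.vertexMaximalBySearch pick I c C a b = true ↔ 𝒢.VertexMaximal I c C a b := by
  simp only [vertexMaximalBySearch]
  rw [dif_pos hC.1, decide_eq_true_iff]
  change (∀ D ∈ _, 𝒢.shrink pick I c (𝒢.score I a b) C a b D = ∅) ↔ _
  set w := (argminOf pick (fun v => (𝒢.inter a b).degree v) C hC.1).1
  have hw : w ∈ C := (argminOf pick (fun v => (𝒢.inter a b).degree v) C hC.1).2
  have hS : ∀ v, v ∈ ((𝒢.inter a b).neighborFinset w \ C).filter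
      (fun v => C ⊆ (𝒢.inter a b).neighborFinset v) ↔
      v ∉ C ∧ ∀ u ∈ C, (𝒢.inter a b).Adj v u := by
    intro v
    simp only [Finset.mem_filter, Finset.mem_sdiff, SimpleGraph.mem_neighborFinset,
      Finset.subset_iff]
    exact ⟨fun h => ⟨h.1.2, fun u hu => h.2 hu⟩,
      fun h => ⟨⟨(h.2 hw).symm, h.1⟩, fun u hu => h.2 hu⟩⟩
  have hunion : ∀ D ∈ maximalCliques (𝒢.inter a b)
      (((𝒢.inter a b).neighborFinset w \ C).filter
        fun v => C ⊆ (𝒢.inter a b).neighborFinset v),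
      𝒢.IsTemporalClique (C ∪ D) a b ∧ Disjoint C D := by
    intro D hD
    obtain ⟨hDS, hne, hcl⟩ := of_mem_maximalCliques hD
    refine ⟨⟨hne.mono Finset.subset_union_right, hC.2.1, isClique_inter_iff.1 ?_⟩,
      Finset.disjoint_right.2 fun v hv => ((hS v).1 (hDS hv)).1⟩
    intro x hx y hy hxy
    rw [Finset.mem_coe, Finset.mem_union] at hx hy
    rcases hx with hx | hx <;> rcases hy with hy | hy
    · exact hC.isClique_inter hx hy hxy
    · exact (((hS y).1 (hDS hy)).2 x hx).symm
    · exact ((hS x).1 (hDS hx)).2 y hy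
    · exact hcl hx hy hxy
  constructor
  · rintro h ⟨C', hC', hCC'⟩
    have hne : (C' \ C).Nonempty := Finset.sdiff_nonempty.2 hCC'.2
    obtain ⟨D, hD, hsub⟩ := exists_mem_maximalCliques (𝒢.inter a b) hne
      (fun v hv => (hS v).2 ⟨(Finset.mem_sdiff.1 hv).2, fun u hu =>
        hC'.1.isClique_inter (Finset.mem_sdiff.1 hv).1 (hCC'.1 hu)
          fun hvu => (Finset.mem_sdiff.1 hv).2 (hvu ▸ hu)⟩)
      (hC'.1.isClique_inter.subset (Finset.coe_subset.2 Finset.sdiff_subset))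
    refine shrink_ne_empty pick hI hI' (hunion D hD).1 (hunion D hD).2 hne hsub ?_ (h D hD)
    rw [Finset.union_sdiff_of_subset hCC'.1]
    exact hC'.2
  · intro h D hD
    by_contra hne
    obtain ⟨hsub, hiso⟩ := shrink_sound hne
    obtain ⟨v, hv⟩ := Finset.nonempty_iff_ne_empty.2 hne
    refine h ⟨_, ⟨(hunion D hD).1.anti ?_ (Finset.union_subset_union_right hsub), hiso⟩,
      (Finset.ssubset_iff_of_subset Finset.subset_union_left).2
        ⟨v, Finset.mem_union_right _ hv, Finset.disjoint_right.1 (hunion D hD).2 (hsub hv)⟩⟩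
    exact hC.1.mono Finset.subset_union_left

lemma exists_vertexMaximal {I : IsolationType} {c : ℚ} {C : Finset V} {a b : ℕ}
    (hC : 𝒢.IsIsolatedClique I c C a b) :
    ∃ K, C ⊆ K ∧ 𝒢.IsIsolatedClique I c K a b ∧ 𝒢.VertexMaximal I c K a b := by
  obtain ⟨K, hCK, hK⟩ := (Set.toFinite {K : Finset V | 𝒢.IsIsolatedClique I c K a b}
    ).exists_le_maximal (a := C) hC
  exact ⟨K, hCK, hK.1, fun ⟨K', hK', hlt⟩ => hlt.2 (hK.2 hK' hlt.1)⟩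

/-- `C` need not be isolated, since the usually types call this test on windows where it may not be.
For alltime-avg, a larger isolated clique extends to a vertex-maximal one, which is in `result`. -/
lemma isVertexMaximal_iff (pick : ChoiceRule V) {trim : TrimmingProcedure V} {I : IsolationType}
    (hI : I ≠ .usuallyMax) {c : ℚ} (htrim : IsTrimming c trim) {C : Finset V} {a b : ℕ}
    (hC : 𝒢.IsTemporalClique C a b) :
    𝒢.isVertexMaximal pick I c (𝒢.collectResult pick trim I c) C a b = true ↔
      𝒢.VertexMaximal I c C a b := by
  cases I with
  | alltimeAvg =>
    simp only [isVertexMaximal, vertexMaximalByComparison, decide_eq_true_iff]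
    refine not_congr ⟨?_, ?_⟩
    · rintro ⟨⟨C', a', b'⟩, hmem, heq, hCC'⟩
      rw [Prod.mk.injEq] at heq
      obtain ⟨rfl, rfl⟩ := heq
      exact ⟨C', isIsolatedClique_of_mem_collectResult hI hmem, hCC'⟩
    · rintro ⟨C', hC', hCC'⟩
      obtain ⟨K, hCK, hK, hmax⟩ := exists_vertexMaximal hC'
      exact ⟨(K, a, b), mem_collectResult_of_vertexMaximal hI pick htrim hK hmax, rfl,
        hCC'.trans_subset hCK⟩
  | usuallyMax => exact absurd rfl hI
  | alltimeMax => exact vertexMaximalBySearch_iff pick hI (by decide) hC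
  | avgAlltime => exact vertexMaximalBySearch_iff pick hI (by decide) hC
  | maxUsually => exact vertexMaximalBySearch_iff pick hI (by decide) hC
  | usuallyAvg => exact vertexMaximalBySearch_iff pick hI (by decide) hC

/-! ### Correctness of the maximality test -/

/-- A characterization of maximality that treats both parts of its definition alike. -/
lemma maximal_iff_forall_window {I : IsolationType} {c : ℚ} {C : Finset V} {a b : ℕ}
    (hab : a ≤ b) : 𝒢.TimeMaximal I c C a b ∧ 𝒢.VertexMaximal I c C a b ↔
      ∀ a' b', a' ≤ a → b ≤ b' →
        ((a, b) ≠ (a', b') → ¬ 𝒢.IsIsolatedClique I c C a' b') ∧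
          𝒢.VertexMaximal I c C a' b' := by
  have hss : ∀ {a' b'}, Finset.Icc a b ⊂ Finset.Icc a' b' ↔
      (a' ≤ a ∧ b ≤ b') ∧ (a, b) ≠ (a', b') := by
    intro a' b'
    rw [ssubset_iff_subset_ne, Finset.Icc_subset_Icc_iff hab]
    refine and_congr_right fun h => not_congr ⟨fun h' => ?_, fun h' => ?_⟩
    -- Both windows are nonempty, so equal intervals have equal endpoints.
    · have h1 := (Finset.Icc_subset_Icc_iff (h.1.trans (hab.trans h.2))).1 h'.symm.subset
      rw [Prod.mk.injEq]
      omega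
    · rw [Prod.mk.injEq] at h'
      rw [h'.1, h'.2]
  constructor
  · rintro ⟨ht, hv⟩ a' b' ha hb
    refine ⟨fun hne hiso => ht ⟨C, a', b', hiso, Finset.Subset.refl _, hss.2 ⟨⟨ha, hb⟩, hne⟩⟩,
      fun ⟨C', hC', hCC'⟩ => ?_⟩
    by_cases hne : (a, b) = (a', b')
    · rw [Prod.mk.injEq] at hne
      rw [← hne.1, ← hne.2] at hC'
      exact hv ⟨C', hC', hCC'⟩
    · exact ht ⟨C', a', b', hC', hCC'.1, hss.2 ⟨⟨ha, hb⟩, hne⟩⟩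
  · refine fun h => ⟨?_, (h a b le_rfl le_rfl).2⟩
    rintro ⟨C', a', b', hC', hCC', hlt⟩
    obtain ⟨⟨ha, hb⟩, hne⟩ := hss.1 hlt
    rcases hCC'.eq_or_ssubset with rfl | hCC'
    · exact (h a' b' ha hb).1 hne hC'
    · exact (h a' b' ha hb).2 ⟨C', hC', hCC'⟩

/-- For the alltime types, isolation is inherited by smaller time windows. -/
lemma IsIsolatedClique.window_anti {I : IsolationType}
    (hI : I = .alltimeAvg ∨ I = .alltimeMax ∨ I = .avgAlltime) {c : ℚ} {C : Finset V}
    {a b a' b' : ℕ} (h : 𝒢.IsIsolatedClique I c C a' b') (ha : a' ≤ a) (hab : a ≤ b)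
    (hb : b ≤ b') : 𝒢.IsIsolatedClique I c C a b := by
  have hsub : Finset.Icc a b ⊆ Finset.Icc a' b' := Finset.Icc_subset_Icc ha hb
  refine ⟨⟨h.1.1, ⟨h.1.2.1.1.trans ha, hab, hb.trans h.1.2.1.2.2⟩,
    fun t ht => h.1.2.2 t (hsub ht)⟩, ?_⟩
  have hiso := h.2
  rcases hI with rfl | rfl | rfl <;> simp only [Isolated] at hiso ⊢ <;>
    refine lt_of_le_of_lt (Nat.cast_le.2 ?_) hiso
  · exact Finset.sup_mono hsub
  · exact Finset.sup_mono_fun fun v _ => Finset.sup_mono hsub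
  · exact Finset.sum_le_sum fun v _ => Finset.sup_mono hsub

/-- A witness on any larger window restricts to a one-step extension if its vertex set is `C`, and
to `[a, b]` itself if its vertex set is larger. -/
lemma isMaximalAlltime_iff (pick : ChoiceRule V) {trim : TrimmingProcedure V} {I : IsolationType}
    (hI : I = .alltimeAvg ∨ I = .alltimeMax ∨ I = .avgAlltime) {c : ℚ}
    (htrim : IsTrimming c trim) {C : Finset V} {a b : ℕ} (hC : 𝒢.IsTemporalClique C a b) :
    𝒢.isMaximalAlltime pick I c (𝒢.collectResult pick trim I c) C a b = true ↔
      𝒢.TimeMaximal I c C a b ∧ 𝒢.VertexMaximal I c C a b := by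
  have hab := hC.2.1.2.1
  have hI' : I ≠ .usuallyMax := by rcases hI with rfl | rfl | rfl <;> decide
  rw [maximal_iff_forall_window hab, isMaximalAlltime]
  split_ifs with h1 h2
  · have := h1.1.2.1.1
    refine iff_of_false not_false ?_
    exact fun h => (h (a - 1) b (Nat.sub_le _ _) le_rfl).1
      (fun heq => by rw [Prod.mk.injEq] at heq; omega) h1
  · refine iff_of_false not_false ?_
    exact fun h => (h a (b + 1) le_rfl (Nat.le_succ _)).1
      (fun heq => by rw [Prod.mk.injEq] at heq; omega) h2
  · rw [isVertexMaximal_iff pick hI' htrim hC]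
    refine ⟨fun h a' b' ha hb => ⟨fun hne hiso => ?_, fun ⟨C', hC', hlt⟩ =>
      h ⟨C', hC'.window_anti hI ha hab hb, hlt⟩⟩, fun h => (h a b le_rfl le_rfl).2⟩
    have : a' < a ∨ b < b' := by
      by_contra hcon
      exact hne (by rw [Prod.mk.injEq]; omega)
    rcases this with h' | h'
    · exact h1 (hiso.window_anti hI (by omega) (by omega) hb)
    · exact h2 (hiso.window_anti hI ha (by omega) h')

/-! ### The nested loops for the usually types -/

/-- A break at a layer where `C` is not a clique shows up as the premise that `C` is a clique in all
layers from `m` to `t`: only such `t` are ever examined. -/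
lemma usuallyInnerLoop_iff (pick : ChoiceRule V) {I : IsolationType} {c : ℚ}
    {result : Finset (Finset V × ℕ × ℕ)} {C : Finset V} {a b a' n m : ℕ} :
    𝒢.usuallyInnerLoop pick I c result C a b a' n m = true ↔
      ∀ t, m ≤ t → t < m + n →
        (∀ j ∈ Finset.Icc m t, (𝒢.layer j).IsClique (C : Set V)) →
        ¬ (𝒢.Isolated I c C a' t ∧ (a, b) ≠ (a', t)) ∧
          𝒢.isVertexMaximal pick I c result C a' t = true := by
  induction n generalizing m with
  | zero =>
    simp only [usuallyInnerLoop, true_iff]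
    intro t h1 h2
    omega
  | succ n ih =>
    rw [usuallyInnerLoop]
    split_ifs with h1 h2 h3
    · refine iff_of_false not_false ?_
      exact fun h => (h m le_rfl (by omega) (by simpa using h1)).1 h2
    · refine iff_of_false not_false ?_
      intro h
      have := (h m le_rfl (by omega) (by simpa using h1)).2
      rw [h3] at this
      exact Bool.false_ne_true this
    · rw [ih]
      constructor
      · intro h t hmt htn hcl
        rcases hmt.eq_or_lt with rfl | hmt
        · exact ⟨h2, by simpa using h3⟩
        · exact h t hmt (by omega) fun j hj =>
            hcl j (Finset.Icc_subset_Icc (Nat.le_succ _) le_rfl hj)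
      · intro h t hmt htn hcl
        refine h t (by omega) (by omega) fun j hj => ?_
        rw [Finset.mem_Icc] at hj
        rcases hj.1.eq_or_lt with rfl | hj'
        · exact h1
        · exact hcl j (Finset.mem_Icc.2 ⟨hj', hj.2⟩)
    · refine iff_of_true rfl ?_
      exact fun t hmt _ h => absurd (h m (Finset.left_mem_Icc.2 hmt)) h1

lemma usuallyOuterLoop_iff (pick : ChoiceRule V) {I : IsolationType} {c : ℚ}
    {result : Finset (Finset V × ℕ × ℕ)} {C : Finset V} {a b n : ℕ} :
    𝒢.usuallyOuterLoop pick I c result C a b n = true ↔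
      ∀ t, 1 ≤ t → t ≤ n → (∀ j ∈ Finset.Icc t n, (𝒢.layer j).IsClique (C : Set V)) →
        𝒢.usuallyInnerLoop pick I c result C a b t (𝒢.τ + 1 - b) b = true := by
  induction n with
  | zero =>
    simp only [usuallyOuterLoop, true_iff]
    intro t h1 h2
    omega
  | succ n ih =>
    rw [usuallyOuterLoop]
    split_ifs with h1 h2
    · refine iff_of_false not_false ?_
      intro h
      have := h (n + 1) (by omega) le_rfl (by simpa using h1)
      rw [h2] at this
      exact Bool.false_ne_true this
    · rw [ih]
      constructor
      · intro h t ht htn hcl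
        rcases htn.eq_or_lt with rfl | htn
        · simpa using h2
        · exact h t ht (by omega) fun j hj =>
            hcl j (Finset.Icc_subset_Icc le_rfl (Nat.le_succ _) hj)
      · intro h t ht htn hcl
        refine h t ht (by omega) fun j hj => ?_
        rw [Finset.mem_Icc] at hj
        rcases hj.2.eq_or_lt with rfl | hj'
        · exact h1
        · exact hcl j (Finset.mem_Icc.2 ⟨hj.1, by omega⟩)
    · refine iff_of_true rfl ?_
      exact fun t _ ht h => absurd (h _ (Finset.right_mem_Icc.2 ht)) h1

/-- The loops visit exactly the windows containing `[a, b]` on which `C` is a temporal clique. No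
other window matters, because an isolated clique on a superset of `C` makes `C` a clique there. -/
lemma isMaximalUsually_iff (pick : ChoiceRule V) {trim : TrimmingProcedure V} {I : IsolationType}
    (hI : I ≠ .usuallyMax) {c : ℚ} (htrim : IsTrimming c trim) {C : Finset V} {a b : ℕ}
    (hC : 𝒢.IsTemporalClique C a b) :
    𝒢.isMaximalUsually pick I c (𝒢.collectResult pick trim I c) C a b = true ↔
      𝒢.TimeMaximal I c C a b ∧ 𝒢.VertexMaximal I c C a b := by
  have hab := hC.2.1.2.1
  have hbτ := hC.2.1.2.2
  rw [maximal_iff_forall_window hab, isMaximalUsually, usuallyOuterLoop_iff]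
  simp only [usuallyInnerLoop_iff]
  constructor
  · intro h a' b' ha hb
    have key : 𝒢.IsTemporalClique C a' b' →
        ¬ (𝒢.Isolated I c C a' b' ∧ (a, b) ≠ (a', b')) ∧ 𝒢.VertexMaximal I c C a' b' := by
      intro hC'
      have h3 := hC'.2.1.2.2
      have := h a' hC'.2.1.1 ha
        (fun j hj => hC'.2.2 j (Finset.Icc_subset_Icc le_rfl (hab.trans hb) hj)) b' hb (by omega)
        (fun j hj => hC'.2.2 j (Finset.Icc_subset_Icc (ha.trans hab) le_rfl hj))
      rwa [isVertexMaximal_iff pick hI htrim hC'] at this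
    refine ⟨fun hne hiso => (key hiso.1).1 ⟨hiso.2, hne⟩, fun ⟨C', hC', hlt⟩ => ?_⟩
    exact (key (hC'.1.anti hC.1 hlt.1)).2 ⟨C', hC', hlt⟩
  · intro h a' ha1 ha hcl b' hb hbn hcl'
    have hC' : 𝒢.IsTemporalClique C a' b' := by
      refine ⟨hC.1, ⟨ha1, ha.trans (hab.trans hb), by omega⟩, fun t ht => ?_⟩
      -- Layers up to `a` are covered by the outer loop, those from `b` on by the inner loop, and
      -- those between by `hC`.
      rw [Finset.mem_Icc] at ht
      rcases le_or_gt t a with h1 | h1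
      · exact hcl t (Finset.mem_Icc.2 ⟨ht.1, h1⟩)
      · rcases le_or_gt b t with h2 | h2
        · exact hcl' t (Finset.mem_Icc.2 ⟨h2, ht.2⟩)
        · exact hC.2.2 t (Finset.mem_Icc.2 ⟨h1.le, h2.le⟩)
    rw [isVertexMaximal_iff pick hI htrim hC']
    exact ⟨fun h' => (h a' b' ha hb).1 h'.2 ⟨hC', h'.1⟩, (h a' b' ha hb).2⟩

lemma isMaximal_iff (pick : ChoiceRule V) {trim : TrimmingProcedure V} {I : IsolationType}
    (hI : I ≠ .usuallyMax) {c : ℚ} (htrim : IsTrimming c trim) {C : Finset V} {a b : ℕ}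
    (hC : 𝒢.IsTemporalClique C a b) :
    𝒢.isMaximal pick I c (𝒢.collectResult pick trim I c) C a b = true ↔
      𝒢.TimeMaximal I c C a b ∧ 𝒢.VertexMaximal I c C a b := by
  cases I with
  | alltimeAvg => exact isMaximalAlltime_iff pick (by decide) htrim hC
  | alltimeMax => exact isMaximalAlltime_iff pick (by decide) htrim hC
  | avgAlltime => exact isMaximalAlltime_iff pick (by decide) htrim hC
  | maxUsually => exact isMaximalUsually_iff pick hI htrim hC
  | usuallyAvg => exact isMaximalUsually_iff pick hI htrim hC
  | usuallyMax => exact absurd rfl hI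

end TemporalGraph

/-! ### Correctness of the whole algorithm -/

theorem mainTheorem2 {V : Type*} [Fintype V] [DecidableEq V] (𝒢 : TemporalGraph V) (c : ℚ)
    (I : IsolationType) (hI : I ≠ IsolationType.usuallyMax) :
    IsTrimming c (pivotTrimming c : TrimmingProcedure V) ∧
    ∀ (trim : TrimmingProcedure V), IsTrimming c trim → ∀ (pick : ChoiceRule V)
      (C : Finset V) (a b : ℕ),
      (C, a, b) ∈ 𝒢.enumerate pick trim I c ↔ 𝒢.IsMaximalIsolatedClique I c C a b := by
  refine ⟨isTrimming_pivotTrimming c, fun trim htrim pick C a b => ?_⟩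
  simp only [TemporalGraph.enumerate, Finset.mem_filter]
  constructor
  · rintro ⟨hmem, hmax⟩
    have hC := TemporalGraph.isIsolatedClique_of_mem_collectResult hI hmem
    exact ⟨hC, (TemporalGraph.isMaximal_iff pick hI htrim hC.1).1 hmax⟩
  · rintro ⟨hC, hmax⟩
    exact ⟨TemporalGraph.mem_collectResult_of_vertexMaximal hI pick htrim hC hmax.2,
      (TemporalGraph.isMaximal_iff pick hI htrim hC.1).2 hmax⟩
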